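/- Let $R$ be a commutative ring and $q\in R$ an invertible element (for instance $R=\mathbb Z[q,q^{-1}]$ with $q$ an indeterminate, or $R$ a field and $q\neq 0$), let $n,r,N$ be natural numbers and $\alpha$ a partition of $n$. **The algebra.** Let $\mathcal E_n=\mathcal E_n(q)$ be the braids and ties algebra over $R$, generated by $g_1,\dots,g_{n-1},e_1,\dots,e_{n-1}$ with relations $g_ig_j=g_jg_i$ and $g_ie_j=e_jg_i$ for $|i-j|>1$; $g_ig_jg_i=g_jg_ig_j$, $e_ig_jg_i=g_jg_ie_j$ and $e_ie_jg_j=e_ig_je_i=g_je_ie_j$ for $|i-j|=1$; $e_ie_j=e_je_i$ for all $i,j$; $g_ie_i=e_ig_i$, $e_i^2=e_i$ and $g_i^2=1+(q-q^{-1})e_ig_i$ for all $i$. The symmetric group $\mathfrak S_n$ acts on $\{1,\dots,n\}$ from the right; for $w=s_{i_1}\cdots s_{i_k}$ a reduced expression in the $s_i=(i,i+1)$ put $\ell(w)=k$ and $g_w=g_{i_1}\cdots g_{i_k}$. Put $E_{i,i+1}=e_i$ and $E_{ij}=g_iE_{i+1,j}g_i^{-1}$ for $i+1<j$, and for a set partition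 $A$ of $\{1,\dots,n\}$ let $E_A$ be the product of the (commuting) $E_{ij}$ over all $i<j$ in the same block of $A$. Order set partitions by $A\subseteq B$ if every block of $B$ is a union of blocks of $A$, let $\mu$ be the Möbius function, and put $\mathbb E_A=\sum_{B\supseteq A}\mu(A,B)E_B$ and $\mathbb E_\alpha=\sum_{|A|=\alpha}\mathbb E_A$, where $|A|=\alpha$ (“$A$ is of type $\alpha$”) means that the block sizes of $A$ are the parts of $\alpha$. Put $\mathcal E_n^\alpha=\mathbb E_\alpha\mathcal E_n$, a two-sided ideal of $\mathcal E_n$ with identity element $\mathbb E_\alpha$; modules are right modules. **Permutation modules.** A composition is a sequence of nonnegative integers with finitely many nonzero entries; an $r$-multicomposition $\boldsymbol\lambda$ of $n$ is an $r$-tuple of compositions with total sum $n$. A row standard $\boldsymbol\lambda$-multitableau is a filling of the nodes of its Young diagram by $1,\dots,n$, each used once, that increases along rows; these form the set $\mathrm{RStd}(\boldsymbol\lambda)$. Let $\mathfrak t^{\boldsymbol\lambda}$ be the multitableau with $1,\dots,n$ in order along the rows of the first component, then of the second, and so on; let $\mathfrak S_{\boldsymbol\lambda}$ be its row stabilizer,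 $A_{\boldsymbol\lambda}$ the set partition whose blocks are the nonempty sets of entries of its components, and $d(\mathfrak t)\in\mathfrak S_n$ the element with $\mathfrak t=\mathfrak t^{\boldsymbol\lambda}d(\mathfrak t)$. Call $\boldsymbol\lambda$ of type $\alpha$ if $A_{\boldsymbol\lambda}$ is. With $x_{\boldsymbol\lambda}=\sum_{w\in\mathfrak S_{\boldsymbol\lambda}}q^{\ell(w)}g_w$ put, for $\boldsymbol\lambda$ of type $\alpha$, $M(\boldsymbol\lambda)=\mathbb E_{A_{\boldsymbol\lambda}}x_{\boldsymbol\lambda}\mathcal E_n^\alpha$, and put $x_{\mathfrak t}=\mathbb E_{A_{\boldsymbol\lambda}}x_{\boldsymbol\lambda}g_{d(\mathfrak t)}$ for $\mathfrak t\in\mathrm{RStd}(\boldsymbol\lambda)$. **Tensor space.** Let $V$ be the free $R$-module with basis $v_i^s$, $1\le i\le N$, $1\le s\le r$. Then $V^{\otimes n}$ is a right $\mathcal E_n$-module, where $e_i$ and $g_i$ act in the factors $i,i+1$ by $\mathbf E$ and $\mathbf G$: $(v_i^s\otimes v_j^t)\mathbf E=v_i^s\otimes v_j^t$ if $s=t$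 and $0$ otherwise; $(v_i^s\otimes v_j^t)\mathbf G$ is $v_j^t\otimes v_i^s$ if $s\ne t$ or if $s=t,\ i<j$, it is $q\,v_i^s\otimes v_j^t$ if $s=t,\ i=j$, and $(q-q^{-1})v_i^s\otimes v_j^t+v_j^t\otimes v_i^s$ if $s=t,\ i>j$. If all components of $\boldsymbol\lambda$ have at most $N$ rows and $\mathfrak t\in\mathrm{RStd}(\boldsymbol\lambda)$, put $v_{\mathfrak t}=v_{i_1}^{s_1}\otimes\cdots\otimes v_{i_n}^{s_n}$, where $i_j$ and $s_j$ are the row and the component number of the node of $\mathfrak t$ containing $j$. **Theorem.** (1) Let $\boldsymbol\lambda$ be an $r$-multicomposition of $n$ of type $\alpha$ all of whose components have at most $N$ rows. Then $x_{\mathfrak t}\in M(\boldsymbol\lambda)$ for all $\mathfrak t\in\mathrm{RStd}(\boldsymbol\lambda)$, and there is a unique $R$-linear map $\iota_{\boldsymbol\lambda}:M(\boldsymbol\lambda)\to V^{\otimes n}$ with $\iota_{\boldsymbol\lambda}(x_{\mathfrak t})=v_{\mathfrak t}$ for all $\mathfrak t\in\mathrm{RStd}(\boldsymbol\lambda)$;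 it is injective and a homomorphism of $\mathcal E_n$-modules, hence an embedding of $\mathcal E_n^\alpha$-modules. (2) $\mathbb E_\alpha V^{\otimes n}$ (the image of $V^{\otimes n}$ under the action of $\mathbb E_\alpha$) is a submodule of $V^{\otimes n}$ that contains the images of all these $\iota_{\boldsymbol\lambda}$, and the $\iota_{\boldsymbol\lambda}$ together give an isomorphism of modules over $\mathcal E_n$, hence over $\mathcal E_n^\alpha$, $$\bigoplus_{\boldsymbol\lambda}M(\boldsymbol\lambda)\;\cong\;\mathbb E_\alpha V^{\otimes n},$$ where $\boldsymbol\lambda$ runs over all $r$-multicompositions of $n$ of type $\alpha$ all of whose components have at most $N$ rows. -/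

import Mathlib

open scoped TensorProduct DirectSum
open MulOpposite (op unop)

noncomputable section

namespace BT

/-! ## The symmetric group

Positions `1, …, n` are modelled by `Fin n` and the index set `1, …, n - 1` by `Fin (n - 1)`.
The symmetric group acts on positions from the right, so the product `u w` of the mathematical
text (first `u`, then `w`) is the function composition `w * u` of `Equiv.Perm (Fin n)`. -/

section Perm

variable {n : ℕ}

/-- The position `i`, for `i` an index of a simple transposition. -/
def lo (i : Fin (n - 1)) : Fin n := ⟨i, by omega⟩

/-- The position `i + 1`, for `i` an index of a simple transposition. -/
def hi (i : Fin (n - 1)) : Fin n := ⟨i + 1, by omega⟩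

/-- The simple transposition `s_i = (i, i + 1)`. -/
def simple (i : Fin (n - 1)) : Equiv.Perm (Fin n) := Equiv.swap (lo i) (hi i)

/-- The element `s_{i_1} s_{i_2} ⋯ s_{i_k}`, acting on the right: first `s_{i_1}`, and so on. -/
def wordPerm : List (Fin (n - 1)) → Equiv.Perm (Fin n)
  | [] => 1
  | i :: l => wordPerm l * simple i

theorem wordPerm_append (l m : List (Fin (n - 1))) :
    wordPerm (l ++ m) = wordPerm m * wordPerm l := by
  induction l with
  | nil => simp [wordPerm]
  | cons i l ih => simp [wordPerm, ih, mul_assoc]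

theorem exists_wordPerm (w : Equiv.Perm (Fin n)) : ∃ l, wordPerm l = w := by
  rcases n with _ | n
  · exact ⟨[], Subsingleton.elim _ _⟩
  · have hw : w ∈ Submonoid.closure
        (Set.range fun i : Fin n ↦ Equiv.swap i.castSucc i.succ) := by
      rw [Equiv.Perm.mclosure_swap_castSucc_succ]; trivial
    induction hw using Submonoid.closure_induction with
    | mem x hx =>
      obtain ⟨i, rfl⟩ := hx
      exact ⟨[i], by simp [wordPerm, simple]; rfl⟩
    | one => exact ⟨[], rfl⟩
    | mul x y _ _ hx hy =>
      obtain ⟨l, rfl⟩ := hx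
      obtain ⟨m, rfl⟩ := hy
      exact ⟨m ++ l, wordPerm_append m l⟩

theorem exists_length (w : Equiv.Perm (Fin n)) :
    ∃ k, ∃ l : List (Fin (n - 1)), l.length = k ∧ wordPerm l = w :=
  (exists_wordPerm w).elim fun l hl ↦ ⟨l.length, l, rfl, hl⟩

open Classical in
/-- The Coxeter length of `w`. -/
def len (w : Equiv.Perm (Fin n)) : ℕ := Nat.find (exists_length w)

open Classical in
/-- A reduced expression of `w`. -/
def reducedWord (w : Equiv.Perm (Fin n)) : List (Fin (n - 1)) :=
  (Nat.find_spec (exists_length w)).choose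

theorem reducedWord_length (w : Equiv.Perm (Fin n)) : (reducedWord w).length = len w := by
  classical exact (Nat.find_spec (exists_length w)).choose_spec.1

theorem wordPerm_reducedWord (w : Equiv.Perm (Fin n)) : wordPerm (reducedWord w) = w := by
  classical exact (Nat.find_spec (exists_length w)).choose_spec.2

theorem len_le (l : List (Fin (n - 1))) : len (wordPerm l) ≤ l.length := by
  classical exact Nat.find_min' (exists_length (wordPerm l)) ⟨l, rfl, rfl⟩

end Perm

/-! ## The braids and ties algebra -/

/-- The generators of the braids and ties algebra. -/
inductive Gen (n : ℕ) : Type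
  | g : Fin (n - 1) → Gen n
  | e : Fin (n - 1) → Gen n

/-- `|i - j| = 1` -/
def Adjacent {m : ℕ} (i j : Fin m) : Prop := (i : ℕ) + 1 = j ∨ (j : ℕ) + 1 = i

/-- `|i - j| > 1` -/
def Distant {m : ℕ} (i j : Fin m) : Prop := (i : ℕ) + 1 < j ∨ (j : ℕ) + 1 < i

section Algebra

variable {R : Type*} [CommRing R]

local notation "γ" => fun i ↦ FreeAlgebra.ι R (Gen.g i)
local notation "ε" => fun i ↦ FreeAlgebra.ι R (Gen.e i)

/-- The defining relations of the braids and ties algebra. -/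
inductive Rel (n : ℕ) (q : Rˣ) : FreeAlgebra R (Gen n) → FreeAlgebra R (Gen n) → Prop
  | gg (i j) (h : Distant i j) : Rel n q (γ i * γ j) (γ j * γ i)
  | ge (i) : Rel n q (γ i * ε i) (ε i * γ i)
  | ggg (i j) (h : Adjacent i j) : Rel n q (γ i * γ j * γ i) (γ j * γ i * γ j)
  | egg (i j) (h : Adjacent i j) : Rel n q (ε i * γ j * γ i) (γ j * γ i * ε j)
  | eeg (i j) (h : Adjacent i j) : Rel n q (ε i * ε j * γ j) (ε i * γ j * ε i)
  | ege (i j) (h : Adjacent i j) : Rel n q (ε i * γ j * ε i) (γ j * ε i * ε j)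
  | ee (i j) : Rel n q (ε i * ε j) (ε j * ε i)
  | ge_distant (i j) (h : Distant i j) : Rel n q (γ i * ε j) (ε j * γ i)
  | e_sq (i) : Rel n q (ε i * ε i) (ε i)
  | g_sq (i) : Rel n q (γ i * γ i) (1 + ((q : R) - (↑q⁻¹ : R)) • (ε i * γ i))

/-- The braids and ties algebra `𝓔_n(q)` over a commutative ring `R` with an invertible
element `q`. -/
def Alg (n : ℕ) (q : Rˣ) : Type _ := RingQuot (Rel n q)

variable {n : ℕ} {q : Rˣ}

instance : Ring (Alg n q) := inferInstanceAs (Ring (RingQuot (Rel n q)))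
instance : Algebra R (Alg n q) := inferInstanceAs (Algebra R (RingQuot (Rel n q)))

/-- The canonical projection from the free algebra. -/
def mk (n : ℕ) (q : Rˣ) : FreeAlgebra R (Gen n) →ₐ[R] Alg n q := RingQuot.mkAlgHom R (Rel n q)

theorem mk_rel {x y : FreeAlgebra R (Gen n)} (h : Rel n q x y) : mk n q x = mk n q y :=
  RingQuot.mkAlgHom_rel R h

/-- The generator `g_i`. -/
def g (q : Rˣ) (i : Fin (n - 1)) : Alg n q := mk n q (FreeAlgebra.ι R (Gen.g i))

/-- The generator `e_i`. -/
def e (q : Rˣ) (i : Fin (n - 1)) : Alg n q := mk n q (FreeAlgebra.ι R (Gen.e i))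

theorem g_mul_e (i : Fin (n - 1)) : g q i * e q i = e q i * g q i := by
  simpa [g, e] using mk_rel (Rel.ge (q := q) i)

theorem g_mul_g (i : Fin (n - 1)) :
    g q i * g q i = 1 + ((q : R) - (↑q⁻¹ : R)) • (e q i * g q i) := by
  simpa [g, e] using mk_rel (Rel.g_sq (q := q) i)

/-- `g_i` as a unit, with inverse `g_i + (q⁻¹ - q) e_i`. -/
def gUnit (q : Rˣ) (i : Fin (n - 1)) : (Alg n q)ˣ where
  val := g q i
  inv := g q i + ((↑q⁻¹ : R) - (q : R)) • e q i
  val_inv := by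
    rw [mul_add, g_mul_g, mul_smul_comm, g_mul_e, add_assoc, ← add_smul]; simp
  inv_val := by
    rw [add_mul, g_mul_g, smul_mul_assoc, add_assoc, ← add_smul]; simp

/-- The element `g_w`. -/
def gPerm (q : Rˣ) (w : Equiv.Perm (Fin n)) : Alg n q := ((reducedWord w).map (g q)).prod

/-- The element `E_{i, i + k + 1}`. -/
def EAux (q : Rˣ) : (k i : ℕ) → i + k + 1 < n → Alg n q
  | 0, i, h => e q ⟨i, by omega⟩
  | k + 1, i, h =>
    (gUnit q ⟨i, by omega⟩).val * EAux q k (i + 1) (by omega) * (gUnit q ⟨i, by omega⟩)⁻¹.val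

/-- The element `E_{ij}`, for `i < j`. -/
def EPair (q : Rˣ) (i j : Fin n) (h : i < j) : Alg n q :=
  EAux q (j - i - 1) i (by have : (i : ℕ) < j := h; omega)

/-- Set partitions of the set of positions; `A ≤ B` means that every block of `B` is a union of
blocks of `A`. -/
abbrev SetPartition (n : ℕ) : Type := Finpartition (Finset.univ : Finset (Fin n))

open Classical in
instance (n : ℕ) : LocallyFiniteOrder (SetPartition n) := Fintype.toLocallyFiniteOrder

/-- The element `E_A`, the product of the `E_{ij}` over all `i < j` in the same block of `A`.
These factors commute; the product is taken in the lexicographic order of the pairs. -/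
def EPart (q : Rˣ) (A : SetPartition n) : Alg n q :=
  ((List.finRange n ×ˢ List.finRange n).map fun p ↦
    if h : p.1 < p.2 ∧ A.part p.1 = A.part p.2 then EPair q p.1 p.2 h.1 else 1).prod

open Classical in
/-- The idempotent `𝔼_A`, defined by means of the Möbius function of the lattice of set
partitions. -/
def idem (q : Rˣ) (A : SetPartition n) : Alg n q :=
  ∑ B with A ≤ B, IncidenceAlgebra.mu ℤ A B • EPart q B

/-- The set partition `A` is of type `α`: the sizes of its blocks are the parts of `α`. -/
def IsOfType (A : SetPartition n) (α : n.Partition) : Prop :=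
  A.parts.val.map Finset.card = α.parts

open Classical in
/-- The central idempotent `𝔼_α`. -/
def idemType (q : Rˣ) (α : n.Partition) : Alg n q :=
  ∑ A : SetPartition n with IsOfType A α, idem q A

/-- The ideal `𝓔_n^α(q) = 𝔼_α 𝓔_n(q)`. Right ideals are submodules for the action of the opposite
ring by right multiplication. -/
def ideal (q : Rˣ) (α : n.Partition) : Submodule (Alg n q)ᵐᵒᵖ (Alg n q) :=
  LinearMap.range (DistribSMul.toLinearMap (Alg n q)ᵐᵒᵖ (Alg n q) (idemType q α))

end Algebra

/-! ## Multicompositions and multitableaux -/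

/-- An `r`-multicomposition of `n`. A composition is a sequence of nonnegative integers with
finitely many nonzero entries; components, rows and columns are numbered from `0`. -/
@[ext]
structure MultiComp (r n : ℕ) where
  part : Fin r → ℕ →₀ ℕ
  sum_part : ∑ p, (part p).sum (fun _ k ↦ k) = n

namespace MultiComp

variable {r n : ℕ} (μ : MultiComp r n)

/-- All components have at most `N` rows. -/
def RowsLE (N : ℕ) : Prop := ∀ p i, N ≤ i → μ.part p i = 0

/-- The Young diagram: nodes are triples (component, row, column), ordered lexicographically. -/
def diagram : Finset (Fin r ×ₗ ℕ ×ₗ ℕ) :=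
  (Finset.univ.sigma fun p : Fin r ↦
    (μ.part p).support.sigma fun i ↦ Finset.range (μ.part p i)).map
  ⟨fun x ↦ toLex (x.1, toLex (x.2.1, x.2.2)), by
    rintro ⟨a, b, c⟩ ⟨a', b', c'⟩ h
    simp only [EmbeddingLike.apply_eq_iff_eq, Prod.mk.injEq] at h
    obtain ⟨rfl, rfl, rfl⟩ := h
    rfl⟩

/-- The component number of a node. -/
def _root_.BT.comp (x : Fin r ×ₗ ℕ ×ₗ ℕ) : Fin r := (ofLex x).1

/-- The row number of a node. -/
def _root_.BT.row (x : Fin r ×ₗ ℕ ×ₗ ℕ) : ℕ := (ofLex (ofLex x).2).1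

/-- The column number of a node. -/
def _root_.BT.col (x : Fin r ×ₗ ℕ ×ₗ ℕ) : ℕ := (ofLex (ofLex x).2).2

theorem mem_diagram (x : Fin r ×ₗ ℕ ×ₗ ℕ) :
    x ∈ μ.diagram ↔ col x < μ.part (comp x) (row x) := by
  simp only [diagram, Finset.mem_map, Finset.mem_sigma, Finset.mem_univ, true_and,
    Finsupp.mem_support_iff, Finset.mem_range]
  constructor
  · rintro ⟨y, ⟨-, hy⟩, rfl⟩
    exact hy
  · intro h
    exact ⟨⟨comp x, row x, col x⟩, ⟨(Nat.zero_le _).trans_lt h |>.ne', h⟩, rfl⟩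

theorem card_diagram : μ.diagram.card = n := by
  simp [diagram, Finset.card_sigma, ← μ.sum_part, Finsupp.sum]

/-- A multitableau: a bijection from the positions to the nodes. -/
abbrev Tab : Type := Fin n ≃ μ.diagram

/-- The multitableau in which the positions appear in order along the rows of the first
component, then along the rows of the second component, and so on. -/
def initialTab : μ.Tab := (μ.diagram.orderIsoOfFin μ.card_diagram).toEquiv

variable {μ} in
/-- The entries increase from left to right in each row. -/
def IsRowStandard (t : μ.Tab) : Prop :=
  ∀ a b, comp (t a).1 = comp (t b).1 → row (t a).1 = row (t b).1 →
    col (t a).1 < col (t b).1 → a < b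

/-- Row standard multitableaux. -/
def RStd : Type := {t : μ.Tab // IsRowStandard t}

variable {μ} in
/-- The permutation `d(t)`, where `t` is obtained from the initial multitableau by replacing each
entry `a` by `a d(t)`. -/
def d (t : μ.Tab) : Equiv.Perm (Fin n) := μ.initialTab.trans t.symm

/-- The Young subgroup, that is the row stabilizer of the initial multitableau. -/
def youngSubgroup : Subgroup (Equiv.Perm (Fin n)) where
  carrier := {w | ∀ a, comp (μ.initialTab (w a)).1 = comp (μ.initialTab a).1 ∧
    row (μ.initialTab (w a)).1 = row (μ.initialTab a).1}
  mul_mem' := by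
    intro u w hu hw a
    exact ⟨(hu (w a)).1.trans (hw a).1, (hu (w a)).2.trans (hw a).2⟩
  one_mem' := fun a ↦ ⟨rfl, rfl⟩
  inv_mem' := by
    intro w hw a
    have h := hw (w⁻¹ a)
    rw [show w (w⁻¹ a) = a from w.apply_symm_apply a] at h
    exact ⟨h.1.symm, h.2.symm⟩

/-- The set partition `A_μ`: its blocks are the nonempty sets of entries of the components of the
initial multitableau. -/
def setPartition : SetPartition n :=
  letI s : Setoid (Fin n) := Setoid.ker fun a ↦ comp (μ.initialTab a).1
  haveI : DecidableRel s.r := fun _ _ ↦ Classical.propDecidable _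
  Finpartition.ofSetoid s

end MultiComp

/-! ## Permutation modules -/

section Permutation

variable {R : Type*} [CommRing R] {r n : ℕ}

open Classical in
/-- The element `x_μ`. -/
def xElt (q : Rˣ) (μ : MultiComp r n) : Alg n q :=
  ∑ w : Equiv.Perm (Fin n) with w ∈ μ.youngSubgroup, ((q : R) ^ len w) • gPerm q w

/-- The permutation module `M(μ) = 𝔼_μ x_μ 𝓔_n^α(q)`, for `μ` of type `α`. -/
def permModule (q : Rˣ) (α : n.Partition) (μ : MultiComp r n) :
    Submodule (Alg n q)ᵐᵒᵖ (Alg n q) :=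
  (ideal q α).map
    (DistribSMul.toLinearMap (Alg n q)ᵐᵒᵖ (Alg n q) (idem q μ.setPartition * xElt q μ))

/-- The element `x_t`, for `t` a row standard multitableau. -/
def xTab (q : Rˣ) {μ : MultiComp r n} (t : μ.RStd) : Alg n q :=
  idem q μ.setPartition * xElt q μ * gPerm q (MultiComp.d t.1)

/-- The `r`-multicompositions of `n` of type `α` whose components have at most `N` rows. -/
def CompLE (r N : ℕ) {n : ℕ} (α : n.Partition) : Type :=
  {μ : MultiComp r n // μ.RowsLE N ∧ IsOfType μ.setPartition α}

end Permutation

/-! ## The tensor space -/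

section Tensor

variable {R : Type*} [CommRing R] {n N r : ℕ}

/-- The letters `(i, s)` that index the basis vectors `v_i^s` of `V`. -/
abbrev Letter (N r : ℕ) : Type := Fin N × Fin r

variable (R n N r) in
/-- The tensor space `V^{⊗ n}`, where `V` is free with basis `v_i^s`. -/
def TensorSpace : Type _ := ⨂[R] _ : Fin n, (Letter N r →₀ R)

instance : AddCommGroup (TensorSpace R n N r) :=
  inferInstanceAs (AddCommGroup (⨂[R] _ : Fin n, (Letter N r →₀ R)))

instance : Module R (TensorSpace R n N r) :=
  inferInstanceAs (Module R (⨂[R] _ : Fin n, (Letter N r →₀ R)))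

variable (R n N r) in
/-- The basis of the tensor space that consists of the pure tensors of the `v_i^s`. -/
def wordBasis : Module.Basis (Fin n → Letter N r) R (TensorSpace R n N r) :=
  Basis.piTensorProduct fun _ ↦ Finsupp.basisSingleOne

/-- The operator `𝐄`, acting in the factors `a` and `b`. -/
def opE (a b : Fin n) : Module.End R (TensorSpace R n N r) :=
  (wordBasis R n N r).constr R fun w ↦
    if (w a).2 = (w b).2 then wordBasis R n N r w else 0

/-- The operator `𝐆`, acting in the factors `a` and `b`. -/
def opG (q : Rˣ) (a b : Fin n) : Module.End R (TensorSpace R n N r) :=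
  (wordBasis R n N r).constr R fun w ↦
    if (w a).2 ≠ (w b).2 then wordBasis R n N r (w ∘ Equiv.swap a b)
    else if (w a).1 = (w b).1 then (q : R) • wordBasis R n N r w
    else if (w a).1 < (w b).1 then wordBasis R n N r (w ∘ Equiv.swap a b)
    else ((q : R) - (↑q⁻¹ : R)) • wordBasis R n N r w
      + wordBasis R n N r (w ∘ Equiv.swap a b)

/-- Diagonal coefficient of `𝐆`. -/
def cG (q : Rˣ) (x y : Letter N r) : R :=
  if x.2 ≠ y.2 then 0 else if x.1 = y.1 then (q : R) else
    if x.1 < y.1 then 0 else (q : R) - (↑q⁻¹ : R)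

variable (R) in
/-- Off-diagonal coefficient of `𝐆`. -/
def dG (x y : Letter N r) : R := if x = y then 0 else 1

variable (R) in
/-- Diagonal coefficient of `𝐄`. -/
def cE (x y : Letter N r) : R := if x.2 = y.2 then 1 else 0

theorem opE_basis (a b : Fin n) (w : Fin n → Letter N r) :
    opE a b (wordBasis R n N r w) = cE R (w a) (w b) • wordBasis R n N r w := by
  rw [opE, Module.Basis.constr_basis, cE]; split_ifs <;> simp

theorem opG_basis (q : Rˣ) (a b : Fin n) (w : Fin n → Letter N r) :
    opG q a b (wordBasis R n N r w) = cG q (w a) (w b) • wordBasis R n N r w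
      + dG R (w a) (w b) • wordBasis R n N r (w ∘ Equiv.swap a b) := by
  rw [opG, Module.Basis.constr_basis, cG, dG]
  simp only [Prod.ext_iff]
  split_ifs <;> simp_all

theorem comp_swap_left (a b : Fin n) (w : Fin n → Letter N r) :
    (w ∘ Equiv.swap a b) a = w b := by simp

theorem comp_swap_right (a b : Fin n) (w : Fin n → Letter N r) :
    (w ∘ Equiv.swap a b) b = w a := by simp

theorem comp_swap_of_ne {a b c : Fin n} (h : c ≠ a) (h' : c ≠ b) (w : Fin n → Letter N r) :
    (w ∘ Equiv.swap a b) c = w c := by simp [Equiv.swap_apply_of_ne_of_ne h h']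

theorem comp_swap_swap (a b : Fin n) (w : Fin n → Letter N r) :
    (w ∘ Equiv.swap a b) ∘ Equiv.swap a b = w := by
  funext x; simp

theorem comp_swap_braid {a b c : Fin n} (hab : a ≠ b) (hac : a ≠ c) (hbc : b ≠ c)
    (w : Fin n → Letter N r) :
    ((w ∘ Equiv.swap b c) ∘ Equiv.swap a b) ∘ Equiv.swap b c
      = ((w ∘ Equiv.swap a b) ∘ Equiv.swap b c) ∘ Equiv.swap a b := by
  funext x
  simp only [Function.comp_apply, Equiv.swap_apply_def]
  congr 1
  grind

theorem comp_swap_comm {a b c d : Fin n} (hac : a ≠ c) (had : a ≠ d) (hbc : b ≠ c) (hbd : b ≠ d)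
    (w : Fin n → Letter N r) :
    (w ∘ Equiv.swap a b) ∘ Equiv.swap c d = (w ∘ Equiv.swap c d) ∘ Equiv.swap a b := by
  funext x
  simp only [Function.comp_apply, Equiv.swap_apply_def]
  congr 1
  grind

variable (q : Rˣ)

theorem opG_sq (a b : Fin n) :
    opG q a b * opG q a b = (1 : Module.End R (TensorSpace R n N r))
      + ((q : R) - (↑q⁻¹ : R)) • (opG q a b * opE a b) := by
  refine (wordBasis R n N r).ext fun w ↦ ?_
  simp only [Module.End.mul_apply, LinearMap.add_apply, LinearMap.smul_apply, opG_basis, opE_basis,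
    map_add, map_smul, Module.End.one_apply, comp_swap_left, comp_swap_right, comp_swap_swap]
  have hq := q.mul_inv
  have key : ∀ x y : Letter N r, (cG q x y * cG q x y + dG R x y * dG R y x =
      1 + ((q : R) - (↑q⁻¹ : R)) * cE R x y * cG q x y) ∧
      (cG q x y * dG R x y + dG R x y * cG q y x =
        ((q : R) - (↑q⁻¹ : R)) * cE R x y * dG R x y) := by
    rintro ⟨i, s⟩ ⟨j, t⟩
    by_cases hst : s = t
    · subst hst
      rcases lt_trichotomy i j with h | h | h
      · simp [cG, dG, cE, h.ne, h.ne', h, h.not_gt]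
      · subst h
        simp only [cG, dG, cE]; simp; linear_combination hq
      · simp [cG, dG, cE, h.ne, h.ne', h, h.not_gt]; ring
    · simp [cG, dG, cE, hst, Ne.symm hst]
  obtain ⟨h1, h2⟩ := key (w a) (w b)
  match_scalars
  · linear_combination h1
  · linear_combination h2

theorem opG_opE (a b : Fin n) :
    (opG q a b * opE a b : Module.End R (TensorSpace R n N r)) = opE a b * opG q a b := by
  refine (wordBasis R n N r).ext fun w ↦ ?_
  simp only [Module.End.mul_apply, opG_basis, opE_basis,
    map_add, map_smul, comp_swap_left, comp_swap_right]
  match_scalars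
  · ring
  · simp only [cE, eq_comm (a := (w b).2)]; ring

theorem opE_sq (a b : Fin n) :
    (opE a b * opE a b : Module.End R (TensorSpace R n N r)) = opE a b := by
  refine (wordBasis R n N r).ext fun w ↦ ?_
  simp only [Module.End.mul_apply, opE_basis, map_smul]
  match_scalars
  by_cases h : (w a).2 = (w b).2 <;> simp [cE, h]

theorem opE_opE (a b c d : Fin n) :
    (opE a b * opE c d : Module.End R (TensorSpace R n N r)) = opE c d * opE a b := by
  refine (wordBasis R n N r).ext fun w ↦ ?_
  simp only [Module.End.mul_apply, opE_basis, map_smul]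
  match_scalars
  ring

theorem opG_opG {a b c d : Fin n} (hac : a ≠ c) (had : a ≠ d) (hbc : b ≠ c) (hbd : b ≠ d) :
    (opG q a b * opG q c d : Module.End R (TensorSpace R n N r)) = opG q c d * opG q a b := by
  refine (wordBasis R n N r).ext fun w ↦ ?_
  simp only [Module.End.mul_apply, opG_basis, map_add, map_smul,
    comp_swap_of_ne hac had, comp_swap_of_ne hbc hbd, comp_swap_of_ne hac.symm hbc.symm,
    comp_swap_of_ne had.symm hbd.symm, comp_swap_comm hac had hbc hbd]
  match_scalars <;> ring

theorem opG_opE_distant {a b c d : Fin n} (hac : a ≠ c) (had : a ≠ d) (hbc : b ≠ c)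
    (hbd : b ≠ d) :
    (opG q a b * opE c d : Module.End R (TensorSpace R n N r)) = opE c d * opG q a b := by
  refine (wordBasis R n N r).ext fun w ↦ ?_
  simp only [Module.End.mul_apply, opG_basis, opE_basis, map_add, map_smul,
    comp_swap_of_ne hac.symm hbc.symm, comp_swap_of_ne had.symm hbd.symm]
  match_scalars <;> ring

theorem coef_cases (x y : Letter N r) :
    (x.2 ≠ y.2 ∧ cG q x y = 0 ∧ cG q y x = 0 ∧ dG R x y = 1 ∧ dG R y x = 1) ∨
    ((x.2 = y.2 ∧ x.1 = y.1) ∧ cG q x y = q ∧ cG q y x = q ∧ dG R x y = 0 ∧ dG R y x = 0) ∨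
    ((x.2 = y.2 ∧ x.1 < y.1) ∧ cG q x y = 0 ∧ cG q y x = (q : R) - (↑q⁻¹ : R) ∧
      dG R x y = 1 ∧ dG R y x = 1) ∨
    ((x.2 = y.2 ∧ y.1 < x.1) ∧ cG q x y = (q : R) - (↑q⁻¹ : R) ∧ cG q y x = 0 ∧
      dG R x y = 1 ∧ dG R y x = 1) := by
  obtain ⟨i, s⟩ := x
  obtain ⟨j, t⟩ := y
  by_cases hst : s = t
  · subst hst
    rcases lt_trichotomy i j with h | h | h
    · simp [cG, dG, h.ne, h.ne', h, h.not_gt]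
    · subst h; simp [cG, dG]
    · simp [cG, dG, h.ne, h.ne', h, h.not_gt]
  · simp [cG, dG, hst, Ne.symm hst]

theorem braid_coef (x y z : Letter N r) :
    cG q x y * cG q y z * dG R x y + dG R x y * cG q x z * cG q y x
      = cG q y z * dG R x y * cG q x z ∧
    cG q x y * dG R y z * cG q x z
      = cG q y z * cG q x y * dG R y z + dG R y z * cG q x z * cG q z y ∧
    cG q x y * cG q y z * cG q x y + dG R x y * cG q x z * dG R y x
      = cG q y z * cG q x y * cG q y z + dG R y z * cG q x z * dG R z y := by
  have hq := q.mul_inv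
  rcases coef_cases q x y with ⟨h1, a1, a2, a3, a4⟩ | ⟨h1, a1, a2, a3, a4⟩ | ⟨h1, a1, a2, a3, a4⟩ |
    ⟨h1, a1, a2, a3, a4⟩ <;>
  rcases coef_cases q y z with ⟨h2, b1, b2, b3, b4⟩ | ⟨h2, b1, b2, b3, b4⟩ | ⟨h2, b1, b2, b3, b4⟩ |
    ⟨h2, b1, b2, b3, b4⟩ <;>
  rcases coef_cases q x z with ⟨h3, c1, -, -, -⟩ | ⟨h3, c1, -, -, -⟩ | ⟨h3, c1, -, -, -⟩ |
    ⟨h3, c1, -, -, -⟩ <;>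
  first
  | (exfalso; clear a1 a2 a3 a4 b1 b2 b3 b4 c1 hq; grind)
  | (rw [a1, a2, a3, a4, b1, b2, b3, b4, c1]
     refine ⟨?_, ?_, ?_⟩ <;> first
      | ring1
      | linear_combination ((q : R) - (↑q⁻¹ : R)) * hq
      | linear_combination -((q : R) - (↑q⁻¹ : R)) * hq)

theorem opG_braid {a b c : Fin n} (hab : a ≠ b) (hac : a ≠ c) (hbc : b ≠ c) :
    (opG q a b * opG q b c * opG q a b : Module.End R (TensorSpace R n N r))
      = opG q b c * opG q a b * opG q b c := by
  refine (wordBasis R n N r).ext fun w ↦ ?_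
  simp only [Module.End.mul_apply, opG_basis, map_add, map_smul,
    comp_swap_left, comp_swap_right, comp_swap_swap, comp_swap_of_ne hac.symm hbc.symm,
    comp_swap_of_ne hab hac, comp_swap_braid hab hac hbc]
  obtain ⟨h1, h2, h3⟩ := braid_coef q (w a) (w b) (w c)
  match_scalars
  · linear_combination h3
  · linear_combination h1
  · linear_combination h2
  · ring
  · ring
  · ring

set_option linter.unusedSimpArgs false
set_option linter.unusedVariables false

theorem cG_mul_cE (x y : Letter N r) : cG q x y * cE R x y = cG q x y := by
  by_cases h : x.2 = y.2 <;> simp [cG, cE, h]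

variable (R) in
theorem cE_comm (x y : Letter N r) : cE R x y = cE R y x := by
  simp only [cE, eq_comm]

variable (R) in
theorem cE_trans (x y z : Letter N r) : cE R x y * cE R y z = cE R x y * cE R x z := by
  simp only [cE]; grind

theorem opG_opG_opE {a b c : Fin n} (hab : a ≠ b) (hac : a ≠ c) (hbc : b ≠ c) :
    (opG q a b * (opG q b c * opE a b) : Module.End R (TensorSpace R n N r))
      = opE b c * (opG q a b * opG q b c) := by
  refine (wordBasis R n N r).ext fun w ↦ ?_
  simp only [Module.End.mul_apply, opG_basis, opE_basis, map_add, map_smul,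
    comp_swap_left, comp_swap_right, comp_swap_swap, comp_swap_of_ne hac.symm hbc.symm,
    comp_swap_of_ne hab hac]
  have h1 := cG_mul_cE q (w a) (w b)
  have h2 := cG_mul_cE q (w b) (w c)
  have h3 := cG_mul_cE q (w a) (w c)
  have h4 := cE_trans R (w a) (w b) (w c)
  have h5 := cE_trans R (w b) (w a) (w c)
  have h6 := cE_trans R (w a) (w c) (w b)
  have h7 := cE_comm R (w a) (w b)
  have h8 := cE_comm R (w b) (w c)
  have h9 := cE_comm R (w a) (w c)
  match_scalars <;> grind

theorem opG_opG_opE_symm {a b c : Fin n} (hab : a ≠ b) (hac : a ≠ c) (hbc : b ≠ c) :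
    (opG q b c * (opG q a b * opE b c) : Module.End R (TensorSpace R n N r))
      = opE a b * (opG q b c * opG q a b) := by
  refine (wordBasis R n N r).ext fun w ↦ ?_
  simp only [Module.End.mul_apply, opG_basis, opE_basis, map_add, map_smul,
    comp_swap_left, comp_swap_right, comp_swap_swap, comp_swap_of_ne hac.symm hbc.symm,
    comp_swap_of_ne hab hac]
  have h1 := cG_mul_cE q (w a) (w b)
  have h2 := cG_mul_cE q (w b) (w c)
  have h3 := cG_mul_cE q (w a) (w c)
  have h4 := cE_trans R (w a) (w b) (w c)
  have h5 := cE_trans R (w b) (w a) (w c)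
  have h6 := cE_trans R (w a) (w c) (w b)
  have h7 := cE_comm R (w a) (w b)
  have h8 := cE_comm R (w b) (w c)
  have h9 := cE_comm R (w a) (w c)
  match_scalars <;> grind

theorem opG_opE_opE {a b c : Fin n} (hab : a ≠ b) (hac : a ≠ c) (hbc : b ≠ c) :
    (opG q b c * (opE b c * opE a b) : Module.End R (TensorSpace R n N r))
      = opE a b * (opG q b c * opE a b) := by
  refine (wordBasis R n N r).ext fun w ↦ ?_
  simp only [Module.End.mul_apply, opG_basis, opE_basis, map_add, map_smul,
    comp_swap_left, comp_swap_right, comp_swap_swap, comp_swap_of_ne hac.symm hbc.symm,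
    comp_swap_of_ne hab hac]
  have h1 := cG_mul_cE q (w a) (w b)
  have h2 := cG_mul_cE q (w b) (w c)
  have h3 := cG_mul_cE q (w a) (w c)
  have h4 := cE_trans R (w a) (w b) (w c)
  have h5 := cE_trans R (w b) (w a) (w c)
  have h6 := cE_trans R (w a) (w c) (w b)
  have h7 := cE_comm R (w a) (w b)
  have h8 := cE_comm R (w b) (w c)
  have h9 := cE_comm R (w a) (w c)
  match_scalars <;> grind

theorem opE_opG_opE {a b c : Fin n} (hab : a ≠ b) (hac : a ≠ c) (hbc : b ≠ c) :
    (opE a b * (opG q b c * opE a b) : Module.End R (TensorSpace R n N r))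
      = opE b c * (opE a b * opG q b c) := by
  refine (wordBasis R n N r).ext fun w ↦ ?_
  simp only [Module.End.mul_apply, opG_basis, opE_basis, map_add, map_smul,
    comp_swap_left, comp_swap_right, comp_swap_swap, comp_swap_of_ne hac.symm hbc.symm,
    comp_swap_of_ne hab hac]
  have h1 := cG_mul_cE q (w a) (w b)
  have h2 := cG_mul_cE q (w b) (w c)
  have h3 := cG_mul_cE q (w a) (w c)
  have h4 := cE_trans R (w a) (w b) (w c)
  have h5 := cE_trans R (w b) (w a) (w c)
  have h6 := cE_trans R (w a) (w c) (w b)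
  have h7 := cE_comm R (w a) (w b)
  have h8 := cE_comm R (w b) (w c)
  have h9 := cE_comm R (w a) (w c)
  match_scalars <;> grind

theorem opG_opE_opE_symm {a b c : Fin n} (hab : a ≠ b) (hac : a ≠ c) (hbc : b ≠ c) :
    (opG q a b * (opE a b * opE b c) : Module.End R (TensorSpace R n N r))
      = opE b c * (opG q a b * opE b c) := by
  refine (wordBasis R n N r).ext fun w ↦ ?_
  simp only [Module.End.mul_apply, opG_basis, opE_basis, map_add, map_smul,
    comp_swap_left, comp_swap_right, comp_swap_swap, comp_swap_of_ne hac.symm hbc.symm,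
    comp_swap_of_ne hab hac]
  have h1 := cG_mul_cE q (w a) (w b)
  have h2 := cG_mul_cE q (w b) (w c)
  have h3 := cG_mul_cE q (w a) (w c)
  have h4 := cE_trans R (w a) (w b) (w c)
  have h5 := cE_trans R (w b) (w a) (w c)
  have h6 := cE_trans R (w a) (w c) (w b)
  have h7 := cE_comm R (w a) (w b)
  have h8 := cE_comm R (w b) (w c)
  have h9 := cE_comm R (w a) (w c)
  match_scalars <;> grind

theorem opE_opG_opE_symm {a b c : Fin n} (hab : a ≠ b) (hac : a ≠ c) (hbc : b ≠ c) :
    (opE b c * (opG q a b * opE b c) : Module.End R (TensorSpace R n N r))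
      = opE a b * (opE b c * opG q a b) := by
  refine (wordBasis R n N r).ext fun w ↦ ?_
  simp only [Module.End.mul_apply, opG_basis, opE_basis, map_add, map_smul,
    comp_swap_left, comp_swap_right, comp_swap_swap, comp_swap_of_ne hac.symm hbc.symm,
    comp_swap_of_ne hab hac]
  have h1 := cG_mul_cE q (w a) (w b)
  have h2 := cG_mul_cE q (w b) (w c)
  have h3 := cG_mul_cE q (w a) (w c)
  have h4 := cE_trans R (w a) (w b) (w c)
  have h5 := cE_trans R (w b) (w a) (w c)
  have h6 := cE_trans R (w a) (w c) (w b)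
  have h7 := cE_comm R (w a) (w b)
  have h8 := cE_comm R (w b) (w c)
  have h9 := cE_comm R (w a) (w c)
  match_scalars <;> grind

/-- The images of the generators, as operators acting from the right. -/
def genAction (N r : ℕ) : Gen n → (Module.End R (TensorSpace R n N r))ᵐᵒᵖ
  | .g i => op (opG q (lo i) (hi i))
  | .e i => op (opE (lo i) (hi i))

theorem genAction_rel {x y : FreeAlgebra R (Gen n)} (h : Rel n q x y) :
    FreeAlgebra.lift R (genAction q N r) x = FreeAlgebra.lift R (genAction q N r) y := by
  have ne : ∀ i : Fin (n - 1), lo i ≠ hi i := by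
    intro i h; simp [lo, hi] at h
  have adj : ∀ {i j : Fin (n - 1)}, (i : ℕ) + 1 = j → hi i = lo j := by
    intro i j h; simp [lo, hi, h]
  have ne' : ∀ {i j : Fin (n - 1)}, (i : ℕ) + 1 = j → lo i ≠ hi j := by
    intro i j h h'; simp [lo, hi] at h'; omega
  have dist : ∀ {i j : Fin (n - 1)}, Distant i j →
      lo i ≠ lo j ∧ lo i ≠ hi j ∧ hi i ≠ lo j ∧ hi i ≠ hi j := by
    intro i j h
    refine ⟨?_, ?_, ?_, ?_⟩ <;> intro h' <;> simp [lo, hi] at h' <;>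
      rcases h with h | h <;> omega
  induction h with
  | gg i j h =>
    obtain ⟨h1, h2, h3, h4⟩ := dist h
    simp [genAction, ← MulOpposite.op_mul, opG_opG q h1 h2 h3 h4]
  | ge i => simp [genAction, ← MulOpposite.op_mul, opG_opE]
  | ggg i j h =>
    rcases h with h | h
    · have := opG_braid (N := N) (r := r) q (ne i) (ne' h) (adj h ▸ ne j)
      simp [genAction, ← MulOpposite.op_mul, ← adj h] at this ⊢
      simpa [mul_assoc] using this
    · have := opG_braid (N := N) (r := r) q (ne j) (ne' h) (adj h ▸ ne i)
      simp [genAction, ← MulOpposite.op_mul, ← adj h] at this ⊢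
      simpa [mul_assoc] using this.symm
  | egg i j h =>
    rcases h with h | h
    · have := opG_opG_opE (N := N) (r := r) q (ne i) (ne' h) (adj h ▸ ne j)
      simpa [genAction, ← MulOpposite.op_mul, ← adj h] using this
    · have := opG_opG_opE_symm (N := N) (r := r) q (ne j) (ne' h) (adj h ▸ ne i)
      simpa [genAction, ← MulOpposite.op_mul, ← adj h] using this
  | eeg i j h =>
    rcases h with h | h
    · have := opG_opE_opE (N := N) (r := r) q (ne i) (ne' h) (adj h ▸ ne j)
      simpa [genAction, ← MulOpposite.op_mul, ← adj h] using this
    · have := opG_opE_opE_symm (N := N) (r := r) q (ne j) (ne' h) (adj h ▸ ne i)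
      simpa [genAction, ← MulOpposite.op_mul, ← adj h] using this
  | ege i j h =>
    rcases h with h | h
    · have := opE_opG_opE (N := N) (r := r) q (ne i) (ne' h) (adj h ▸ ne j)
      simpa [genAction, ← MulOpposite.op_mul, ← adj h] using this
    · have := opE_opG_opE_symm (N := N) (r := r) q (ne j) (ne' h) (adj h ▸ ne i)
      simpa [genAction, ← MulOpposite.op_mul, ← adj h] using this
  | ee i j => simp [genAction, ← MulOpposite.op_mul, opE_opE (lo i) (hi i)]
  | ge_distant i j h =>
    obtain ⟨h1, h2, h3, h4⟩ := dist h
    simp [genAction, ← MulOpposite.op_mul, opG_opE_distant q h1 h2 h3 h4]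
  | e_sq i => simp [genAction, ← MulOpposite.op_mul, opE_sq]
  | g_sq i =>
    simp [genAction, ← MulOpposite.op_mul, opG_sq]

/-- The right action of the braids and ties algebra on the tensor space, given on generators by
`e_i ↦ 𝐄_i` and `g_i ↦ 𝐆_i`. -/
def tensorAction (n N r : ℕ) :
    Alg n q →ₐ[R] (Module.End R (TensorSpace R n N r))ᵐᵒᵖ :=
  RingQuot.liftAlgHom R ⟨FreeAlgebra.lift R (genAction q N r), fun _ _ h ↦ genAction_rel q h⟩

theorem tensorAction_g (i : Fin (n - 1)) :
    tensorAction q n N r (g q i) = op (opG q (lo i) (hi i)) :=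
  (RingQuot.liftAlgHom_mkAlgHom_apply ..).trans (FreeAlgebra.lift_ι_apply ..)

theorem tensorAction_e (i : Fin (n - 1)) :
    tensorAction q n N r (e q i) = op (opE (lo i) (hi i)) :=
  (RingQuot.liftAlgHom_mkAlgHom_apply ..).trans (FreeAlgebra.lift_ι_apply ..)

/-- The tensor space as a right module over the braids and ties algebra. -/
instance : Module (Alg n q)ᵐᵒᵖ (TensorSpace R n N r) where
  smul a v := (tensorAction q n N r (unop a)).unop v
  one_smul v := by
    change (tensorAction q n N r 1).unop v = v
    simp
  mul_smul a b v := by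
    change (tensorAction q n N r (unop b * unop a)).unop v = _
    rw [map_mul]; rfl
  smul_zero a := map_zero (tensorAction q n N r (unop a)).unop
  smul_add a := map_add (tensorAction q n N r (unop a)).unop
  add_smul a b v := by
    change (tensorAction q n N r (unop a + unop b)).unop v = _
    rw [map_add]; rfl
  zero_smul v := by
    change (tensorAction q n N r 0).unop v = 0
    simp

theorem op_smul_tensor (a : Alg n q) (v : TensorSpace R n N r) :
    op a • v = (tensorAction q n N r a).unop v := rfl

/-- The pure tensor `v_t`, for `t` a row standard multitableau whose shape has at most `N` rows in
each component: its `j`-th factor is `v_i^s`, where `i` and `s` are the row number and the component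
number of the node of `t` containing `j`. -/
def vTab (R : Type*) [CommRing R] {μ : MultiComp r n} (hμ : μ.RowsLE N) (t : μ.RStd) :
    TensorSpace R n N r :=
  ⨂ₜ[R] j : Fin n, Finsupp.single
    (⟨row (t.1 j).1, by
      by_contra h
      have hm := (μ.mem_diagram _).1 (t.1 j).2
      rw [hμ _ _ (not_lt.1 h)] at hm
      exact Nat.not_lt_zero _ hm⟩, comp (t.1 j).1) 1

end Tensor
end BT
end

/-! The elements `xTab q t` of M(λ) and the pure tensors `vTab R hμ t` are indexed by the same row
standard multitableaux, and the generators act on both by the same formulas. The generator e_i acts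
by 1 or 0, according to whether i and i + 1 lie in the same component of t or not. The generator g_i
multiplies by q if i and i + 1 lie in one row. Otherwise it exchanges them, with an additional term
(q - q⁻¹) times the old element when they lie in one component and i + 1 comes before i in the order
of the nodes. So x_t ↦ v_t is a module homomorphism as soon as the x_t are an R-basis of M(λ).

They span, because by these formulas their span is stable under all generators and M(λ) is generated
by the element of the initial multitableau (`mul_mem_span_xTab`). They are independent
(`linearIndependent_xTab`) by the action on tensor space itself, with N replaced by n: on a word
with pairwise distinct letters, g_w merely permutes the letters, so x_t yields a combination of
words over the coset of the row stabilizer belonging to d(t), with coefficient 1 at d(t), and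
different t have disjoint cosets. No basis of 𝓔_n is needed, and R is arbitrary.

The formulas for x_t rest on two facts. Conjugation by g_j permutes the E_{ab} as s_j permutes
positions (`gConj_smul_tie`), which makes the E_{ab} commuting idempotents satisfying a transitivity
relation. By Möbius inversion, 𝔼_A E_{ab} is 𝔼_A or 0 according to whether A joins a and b or not
(`idem_mul_tie`). Conversely, a vector on which the E_{ab} act by 1 or 0 according to a set
partition K is fixed by 𝔼_K and killed by every other 𝔼_A (`op_idem_smul`); both x_t and the basis
words of tensor space are such vectors.

For the direct sum, words of length n correspond bijectively to pairs of a shape with at most N rows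
per component and a row standard multitableau of that shape. The v_t of all shapes are thus distinct
basis words, and 𝔼_α projects tensor space onto the words whose shape has type α. -/

noncomputable section

namespace BT

/-! ## Length, inversions and reduced expressions -/

section Length

variable {n : ℕ}

@[simp] theorem lo_val (i : Fin (n - 1)) : (lo i : ℕ) = i := rfl

@[simp] theorem hi_val (i : Fin (n - 1)) : (hi i : ℕ) = i + 1 := rfl

theorem lo_lt_hi (i : Fin (n - 1)) : lo i < hi i := by
  rw [Fin.lt_def]; simp

theorem lo_ne_hi (i : Fin (n - 1)) : lo i ≠ hi i := (lo_lt_hi i).ne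

@[simp] theorem simple_lo (i : Fin (n - 1)) : simple i (lo i) = hi i := Equiv.swap_apply_left _ _

@[simp] theorem simple_hi (i : Fin (n - 1)) : simple i (hi i) = lo i := Equiv.swap_apply_right _ _

theorem simple_of_ne {i : Fin (n - 1)} {a : Fin n} (h : a ≠ lo i) (h' : a ≠ hi i) :
    simple i a = a := Equiv.swap_apply_of_ne_of_ne h h'

@[simp] theorem simple_simple (i : Fin (n - 1)) (a : Fin n) : simple i (simple i a) = a :=
  Equiv.swap_apply_self ..

@[simp] theorem simple_mul_self (i : Fin (n - 1)) : simple i * simple i = 1 :=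
  Equiv.swap_mul_self _ _

@[simp] theorem simple_inv (i : Fin (n - 1)) : (simple i)⁻¹ = simple i := Equiv.swap_inv _ _

theorem simple_val (i : Fin (n - 1)) (a : Fin n) :
    (simple i a : ℕ) = if (a : ℕ) = i then (i : ℕ) + 1 else if (a : ℕ) = i + 1 then (i : ℕ)
      else a := by
  simp only [simple, Equiv.swap_apply_def, Fin.ext_iff, lo_val, hi_val]
  split_ifs <;> simp_all

/-- A simple transposition preserves the order of every pair except `(i, i + 1)`. -/
theorem simple_lt_simple {i : Fin (n - 1)} {a b : Fin n} (h : a < b)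
    (hne : ¬ (a = lo i ∧ b = hi i)) : simple i a < simple i b := by
  rw [Fin.lt_def] at h ⊢
  simp only [Fin.ext_iff, lo_val, hi_val] at hne
  rw [simple_val, simple_val]
  split_ifs <;> omega

/-- The inversions of a permutation. -/
def inversions (w : Equiv.Perm (Fin n)) : Finset (Fin n × Fin n) :=
  {p | p.1 < p.2 ∧ w p.2 < w p.1}

theorem mem_inversions {w : Equiv.Perm (Fin n)} {p : Fin n × Fin n} :
    p ∈ inversions w ↔ p.1 < p.2 ∧ w p.2 < w p.1 := by
  simp [inversions]

/-- Applying `simple i` to both entries of a pair matches the inversions of `w * simple i` other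
than `(lo i, hi i)` with the inversions of `w`; the exceptional pair is the new inversion. -/
theorem card_inversions_mul_simple {w : Equiv.Perm (Fin n)} {i : Fin (n - 1)}
    (h : w (lo i) < w (hi i)) :
    (inversions (w * simple i)).card = (inversions w).card + 1 := by
  have hmem : (lo i, hi i) ∈ inversions (w * simple i) := by
    simp [mem_inversions, lo_lt_hi, h]
  rw [← Finset.card_erase_add_one hmem]
  congr 1
  refine Finset.card_equiv (Equiv.prodCongr (simple i) (simple i)) fun p ↦ ?_
  simp only [Finset.mem_erase, mem_inversions, Equiv.prodCongr_apply, Prod.map,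
    Equiv.Perm.mul_apply]
  constructor
  · rintro ⟨h1, h2, h3⟩
    exact ⟨simple_lt_simple h2 fun h' ↦ h1 (Prod.ext h'.1 h'.2), h3⟩
  · rintro ⟨h1, h2⟩
    have h3 : ¬ (simple i p.1 = lo i ∧ simple i p.2 = hi i) := by
      rintro ⟨h4, h5⟩
      rw [h4, h5] at h2
      exact h2.not_gt h
    refine ⟨?_, by simpa using simple_lt_simple h1 h3, h2⟩
    rintro rfl
    simp only [simple_lo, simple_hi] at h1
    exact h1.not_gt (lo_lt_hi i)

theorem card_inversions_mul_simple_of_gt {w : Equiv.Perm (Fin n)} {i : Fin (n - 1)}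
    (h : w (hi i) < w (lo i)) :
    (inversions (w * simple i)).card + 1 = (inversions w).card := by
  have := card_inversions_mul_simple (w := w * simple i) (i := i) (by simpa using h)
  rw [mul_assoc, simple_mul_self, mul_one] at this
  exact this.symm

theorem card_inversions_wordPerm_le (l : List (Fin (n - 1))) :
    (inversions (wordPerm l)).card ≤ l.length := by
  induction l with
  | nil =>
    rw [Finset.card_eq_zero.2]
    · simp
    · ext p
      simpa [mem_inversions, wordPerm] using fun h ↦ le_of_lt h
  | cons i l ih =>
    rw [wordPerm, List.length_cons]
    rcases lt_or_gt_of_ne ((wordPerm l).injective.ne (lo_ne_hi i)) with h | h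
    · rw [card_inversions_mul_simple h]; omega
    · have := card_inversions_mul_simple_of_gt h; omega

/-- A permutation without descents is trivial. -/
theorem exists_descent {w : Equiv.Perm (Fin n)} (hw : w ≠ 1) : ∃ i, w (hi i) < w (lo i) := by
  by_contra! h
  apply hw
  have hmono : StrictMono w := by
    rcases n with _ | n
    · exact fun a ↦ a.elim0
    · refine Fin.strictMono_iff_lt_succ.2 fun i ↦ ?_
      exact lt_of_le_of_ne (h i) (w.injective.ne (lo_ne_hi (n := n + 1) i))
  ext a
  have := congrArg (fun f : Fin n ≃o Fin n ↦ f a)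
    (Subsingleton.elim (hmono.orderIsoOfSurjective w w.surjective) (OrderIso.refl _))
  simpa using congrArg Fin.val this

/-- Removing descents one at a time sorts `w` in as many steps as it has inversions; conversely each
letter of an expression creates at most one inversion. -/
theorem len_eq_card_inversions (w : Equiv.Perm (Fin n)) : len w = (inversions w).card := by
  refine le_antisymm ?_ ?_
  · suffices h : ∃ l, wordPerm l = w ∧ l.length = (inversions w).card by
      obtain ⟨l, rfl, hl⟩ := h
      exact hl ▸ len_le l
    induction hk : (inversions w).card generalizing w with
    | zero =>
      refine ⟨[], ?_, rfl⟩
      by_contra hw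
      obtain ⟨i, hi⟩ := exists_descent (w := w) fun h ↦ hw h.symm
      have := card_inversions_mul_simple_of_gt hi
      omega
    | succ k ih =>
      obtain ⟨i, hi⟩ := exists_descent (w := w) (by
        rintro rfl
        have := card_inversions_wordPerm_le (n := n) []
        simp only [wordPerm, List.length_nil] at this
        omega)
      have := card_inversions_mul_simple_of_gt hi
      obtain ⟨l, hl, hl'⟩ := ih (w * simple i) (by omega)
      exact ⟨i :: l, by rw [wordPerm, hl, mul_assoc, simple_mul_self, mul_one], by simp [hl']⟩
  · conv_lhs => rw [← wordPerm_reducedWord w]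
    exact (card_inversions_wordPerm_le _).trans (reducedWord_length w).le

theorem len_mul_simple {w : Equiv.Perm (Fin n)} {i : Fin (n - 1)} (h : w (lo i) < w (hi i)) :
    len (w * simple i) = len w + 1 := by
  simp only [len_eq_card_inversions, card_inversions_mul_simple h]

theorem len_mul_simple_of_gt {w : Equiv.Perm (Fin n)} {i : Fin (n - 1)}
    (h : w (hi i) < w (lo i)) : len (w * simple i) + 1 = len w := by
  simp only [len_eq_card_inversions, card_inversions_mul_simple_of_gt h]

theorem wordPerm_reverse (l : List (Fin (n - 1))) : wordPerm l.reverse = (wordPerm l)⁻¹ := by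
  induction l with
  | nil => simp [wordPerm]
  | cons i l ih => simp [wordPerm, wordPerm_append, ih]

theorem len_inv (w : Equiv.Perm (Fin n)) : len w⁻¹ = len w := by
  have key : ∀ w : Equiv.Perm (Fin n), len w⁻¹ ≤ len w := fun w ↦ by
    conv_lhs => rw [← wordPerm_reducedWord w, ← wordPerm_reverse]
    exact (len_le _).trans (by rw [List.length_reverse, reducedWord_length])
  exact le_antisymm (key w) (by simpa using key w⁻¹)

/-- Since products are compositions read backwards, `simple i * w` is the element w s_i of the
right-action convention, and `w * simple i` is s_i w. -/
theorem len_simple_mul {w : Equiv.Perm (Fin n)} {i : Fin (n - 1)}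
    (h : w⁻¹ (lo i) < w⁻¹ (hi i)) : len (simple i * w) = len w + 1 := by
  rw [← len_inv, mul_inv_rev, simple_inv, len_mul_simple h, len_inv]

@[simp] theorem len_one : len (1 : Equiv.Perm (Fin n)) = 0 :=
  Nat.le_zero.1 (len_le (n := n) [])

/-- An expression as short as possible. -/
def IsReduced (l : List (Fin (n - 1))) : Prop := len (wordPerm l) = l.length

theorem isReduced_reducedWord (w : Equiv.Perm (Fin n)) : IsReduced (reducedWord w) := by
  rw [IsReduced, wordPerm_reducedWord, reducedWord_length]

theorem IsReduced.of_cons {i : Fin (n - 1)} {l : List (Fin (n - 1))} (h : IsReduced (i :: l)) :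
    IsReduced l ∧ wordPerm l (lo i) < wordPerm l (hi i) := by
  have h1 := len_le l
  rw [IsReduced, wordPerm, List.length_cons] at h
  rcases lt_or_gt_of_ne ((wordPerm l).injective.ne (lo_ne_hi i)) with h' | h'
  · rw [len_mul_simple h'] at h
    exact ⟨by rw [IsReduced]; omega, h'⟩
  · have := len_mul_simple_of_gt h'
    omega

theorem Adjacent.symm {m : ℕ} {i j : Fin m} (h : Adjacent i j) : Adjacent j i := Or.symm h

theorem simple_comm {i j : Fin (n - 1)} (h : Distant i j) :
    simple i * simple j = simple j * simple i := by
  ext a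
  simp only [Equiv.Perm.mul_apply, simple_val]
  rcases h with h | h <;> split_ifs <;> omega

theorem simple_braid {i j : Fin (n - 1)} (h : Adjacent i j) :
    simple i * simple j * simple i = simple j * simple i * simple j := by
  wlog hij : (i : ℕ) + 1 = j generalizing i j
  · exact (this h.symm (h.resolve_left hij)).symm
  have h1 : lo j = hi i := Fin.ext hij.symm
  have h2 := lo_ne_hi i
  have h3 : hi i ≠ hi j := h1 ▸ lo_ne_hi j
  have h4 : lo i ≠ hi j := by simp only [ne_eq, Fin.ext_iff, lo_val, hi_val]; omega
  simp only [simple, h1]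
  generalize hi i = b at *
  refine Equiv.ext fun a ↦ ?_
  simp only [Equiv.Perm.mul_apply, Equiv.swap_apply_def]
  grind

theorem eq_or_adjacent_or_distant {m : ℕ} (i j : Fin m) :
    i = j ∨ Adjacent i j ∨ Distant i j := by
  rw [Fin.ext_iff, Adjacent, Distant]; omega

/-- Two adjacent descents mean that `v` is decreasing on three consecutive positions. Hence `v` is
longest in its coset of the copy of the symmetric group on three letters generated by `simple i` and
`simple j`, and the length keeps dropping along the whole braid word. -/
theorem len_of_two_descents {v : Equiv.Perm (Fin n)} {i j : Fin (n - 1)} (hij : Adjacent i j)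
    (hvi : v (hi i) < v (lo i)) (hvj : v (hi j) < v (lo j)) :
    len (v * simple i * simple j) + 1 = len (v * simple i) ∧
      len (v * simple i * simple j * simple i) + 1 = len (v * simple i * simple j) := by
  constructor <;> apply len_mul_simple_of_gt <;> simp only [Equiv.Perm.mul_apply] <;>
    rcases hij with hij | hij
  · have ha : simple i (hi j) = hi j :=
      simple_of_ne (by simp [Fin.ext_iff]; omega) (by simp [Fin.ext_iff]; omega)
    have hb : lo j = hi i := by simp [Fin.ext_iff, hij]
    rw [ha, hb, simple_hi]
    rw [hb] at hvj
    exact hvj.trans hvi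
  · have ha : simple i (lo j) = lo j :=
      simple_of_ne (by simp [Fin.ext_iff]; omega) (by simp [Fin.ext_iff]; omega)
    have hb : hi j = lo i := by simp [Fin.ext_iff, hij]
    rw [ha, hb, simple_lo]
    rw [hb] at hvj
    exact hvi.trans hvj
  · have hb : lo j = hi i := by simp [Fin.ext_iff, hij]
    have ha : simple j (lo i) = lo i :=
      simple_of_ne (by simp [Fin.ext_iff]; omega) (by simp [Fin.ext_iff]; omega)
    have hc : simple i (hi j) = hi j :=
      simple_of_ne (by simp [Fin.ext_iff]; omega) (by simp [Fin.ext_iff]; omega)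
    rw [ha, ← hb, simple_lo, hc, simple_lo, ← hb]
    exact hvj
  · have hb : hi j = lo i := by simp [Fin.ext_iff, hij]
    have ha : simple j (hi i) = hi i :=
      simple_of_ne (by simp [Fin.ext_iff]; omega) (by simp [Fin.ext_iff]; omega)
    have hc : simple i (lo j) = lo j :=
      simple_of_ne (by simp [Fin.ext_iff]; omega) (by simp [Fin.ext_iff]; omega)
    rw [ha, simple_hi, ← hb, simple_hi, hc]
    exact hvj

/-- Matsumoto's theorem for the symmetric group: in a monoid in which the braid relations hold,
the product along a reduced expression depends only on the permutation. -/
theorem prod_map_eq_of_isReduced {M : Type*} [Monoid M] {f : Fin (n - 1) → M}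
    (hcomm : ∀ i j, Distant i j → f i * f j = f j * f i)
    (hbraid : ∀ i j, Adjacent i j → f i * f j * f i = f j * f i * f j)
    {l m : List (Fin (n - 1))} (hl : IsReduced l) (hm : IsReduced m)
    (h : wordPerm l = wordPerm m) : (l.map f).prod = (m.map f).prod := by
  induction hk : l.length using Nat.strong_induction_on generalizing l m with
  | _ k ih =>
  have hlen : l.length = m.length := by rw [← hl, ← hm, h]
  rcases l with _ | ⟨i, l⟩
  · rw [List.length_eq_zero_iff.1 hlen.symm]
  rcases m with _ | ⟨j, m⟩
  · simp at hlen
  obtain ⟨hl', hi'⟩ := hl.of_cons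
  obtain ⟨hm', hj'⟩ := hm.of_cons
  simp only [List.length_cons] at hk hlen
  simp only [List.map_cons, List.prod_cons]
  simp only [wordPerm] at h
  -- A letter that raises the length by one extends a reduced word to a reduced word.
  have red : ∀ {w v : Equiv.Perm (Fin n)} {i' : Fin (n - 1)} {k : ℕ}, len w = k →
      w * simple i' = v → len v = k + 1 → wordPerm (i' :: reducedWord w) = v ∧ IsReduced (i' :: reducedWord w) := by
    intro w v i' k h1 h2 h3
    have : wordPerm (i' :: reducedWord w) = v := by rw [wordPerm, wordPerm_reducedWord, h2]
    exact ⟨this, by rw [IsReduced, this, List.length_cons, reducedWord_length, h1, h3]⟩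
  set v := wordPerm l * simple i with hv
  have e1 : v * simple i = wordPerm l := by rw [hv, mul_assoc, simple_mul_self, mul_one]
  have e2 : v * simple j = wordPerm m := by rw [h, mul_assoc, simple_mul_self, mul_one]
  have hvi : v (hi i) < v (lo i) := by simpa [hv] using hi'
  have hvj : v (hi j) < v (lo j) := by simpa [h] using hj'
  rcases eq_or_adjacent_or_distant i j with rfl | hij | hij
  · rw [ih l.length (by omega) hl' hm' (mul_right_cancel h) rfl]
  -- Adjacent first letters: with `u` the shortest element of the coset of `v`, induction replaces
  -- the tails `l` and `m` by `j :: i :: reducedWord u` and `i :: j :: reducedWord u`. The two words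
  -- then differ by one braid relation.
  · set u := v * simple i * simple j * simple i with hu
    have hu' : u = v * simple j * simple i * simple j := by
      rw [hu, mul_assoc v, mul_assoc v, simple_braid hij, ← mul_assoc, ← mul_assoc]
    obtain ⟨k1, k2⟩ := len_of_two_descents hij hvi hvj
    obtain ⟨k3, k4⟩ := len_of_two_descents hij.symm hvj hvi
    rw [← hu] at k2
    rw [← hu'] at k4
    rw [e1, hl'] at k1
    rw [e2, hm'] at k3
    rw [e1] at k2
    rw [e2] at k4
    obtain ⟨a1, a2⟩ := red (w := u) (i' := i) (v := v * simple i * simple j) rfl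
      (by rw [hu, mul_assoc, simple_mul_self, mul_one]) (by rw [e1]; omega)
    obtain ⟨b1, b2⟩ := red (w := u) (i' := j) (v := v * simple j * simple i) rfl
      (by rw [hu', mul_assoc, simple_mul_self, mul_one]) (by rw [e2]; omega)
    have c1 : wordPerm (j :: i :: reducedWord u) = wordPerm l := by
      rw [wordPerm, a1, mul_assoc, simple_mul_self, mul_one, e1]
    have c2 : wordPerm (i :: j :: reducedWord u) = wordPerm m := by
      rw [wordPerm, b1, mul_assoc, simple_mul_self, mul_one, e2]
    have d1 : IsReduced (j :: i :: reducedWord u) := by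
      rw [IsReduced, c1, hl']
      simp only [List.length_cons, reducedWord_length]; omega
    have d2 : IsReduced (i :: j :: reducedWord u) := by
      rw [IsReduced, c2, hm']
      simp only [List.length_cons, reducedWord_length]; omega
    rw [ih l.length (by omega) hl' d1 c1.symm rfl,
      ih m.length (by omega) hm' d2 c2.symm rfl]
    simp only [List.map_cons, List.prod_cons, ← mul_assoc]
    rw [hbraid i j hij]
  -- Distant first letters: the tails become `j :: reducedWord u` and `i :: reducedWord u`, and one
  -- commutation remains.
  · set u := v * simple i * simple j with hu
    have hu' : u = v * simple j * simple i := by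
      rw [hu, mul_assoc v, simple_comm hij, ← mul_assoc]
    have hlu : len u + 1 = len (wordPerm l) := by
      rw [hu, ← e1]
      apply len_mul_simple_of_gt
      have h1 : simple i (lo j) = lo j := by
        apply simple_of_ne <;> simp only [ne_eq, Fin.ext_iff, lo_val, hi_val] <;>
          rcases hij with h | h <;> omega
      have h2 : simple i (hi j) = hi j := by
        apply simple_of_ne <;> simp only [ne_eq, Fin.ext_iff, lo_val, hi_val] <;>
          rcases hij with h | h <;> omega
      rwa [Equiv.Perm.mul_apply v, Equiv.Perm.mul_apply v, h1, h2]
    obtain ⟨a1, a2⟩ := red (w := u) (i' := j) (v := wordPerm l) rfl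
      (by rw [hu, e1, mul_assoc, simple_mul_self, mul_one]) (by omega)
    obtain ⟨b1, b2⟩ := red (w := u) (i' := i) (v := wordPerm m) rfl
      (by rw [hu', e2, mul_assoc, simple_mul_self, mul_one]) (by rw [hm', hlu, hl']; omega)
    rw [ih l.length (by omega) hl' a2 a1.symm rfl, ih m.length (by omega) hm' b2 b1.symm rfl]
    simp only [List.map_cons, List.prod_cons, ← mul_assoc]
    rw [hcomm i j hij]

end Length

/-! ### The elements g_w and their products with the g_i. -/

section GPerm

variable {R : Type*} [CommRing R] {n : ℕ} {q : Rˣ}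

theorem g_comm {i j : Fin (n - 1)} (h : Distant i j) : g q i * g q j = g q j * g q i := by
  simpa [g] using mk_rel (Rel.gg (q := q) i j h)

theorem g_braid {i j : Fin (n - 1)} (h : Adjacent i j) :
    g q i * g q j * g q i = g q j * g q i * g q j := by
  simpa [g] using mk_rel (Rel.ggg (q := q) i j h)

theorem gPerm_wordPerm {l : List (Fin (n - 1))} (hl : IsReduced l) :
    gPerm q (wordPerm l) = (l.map (g q)).prod :=
  prod_map_eq_of_isReduced (fun _ _ h ↦ g_comm h) (fun _ _ h ↦ g_braid h)
    (isReduced_reducedWord _) hl (wordPerm_reducedWord _)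

@[simp] theorem gPerm_one : gPerm q (1 : Equiv.Perm (Fin n)) = 1 :=
  gPerm_wordPerm (l := []) (by simp [IsReduced, wordPerm])

theorem g_mul_gPerm {w : Equiv.Perm (Fin n)} {i : Fin (n - 1)} (h : w (lo i) < w (hi i)) :
    g q i * gPerm q w = gPerm q (w * simple i) := by
  have h1 : wordPerm (i :: reducedWord w) = w * simple i := by
    rw [wordPerm, wordPerm_reducedWord]
  rw [← h1, gPerm_wordPerm, List.map_cons, List.prod_cons, gPerm]
  rw [IsReduced, h1, len_mul_simple h, List.length_cons, reducedWord_length]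

theorem gPerm_mul_g {w : Equiv.Perm (Fin n)} {i : Fin (n - 1)} (h : w⁻¹ (lo i) < w⁻¹ (hi i)) :
    gPerm q w * g q i = gPerm q (simple i * w) := by
  have h1 : wordPerm (reducedWord w ++ [i]) = simple i * w := by
    rw [wordPerm_append, wordPerm_reducedWord]; simp [wordPerm]
  rw [← h1, gPerm_wordPerm, List.map_append, List.prod_append, gPerm]
  · simp
  · rw [IsReduced, h1, len_simple_mul h, List.length_append, reducedWord_length]; simp

/-- Here `simple i * w` is shorter, so g_w ends in g_i and the quadratic relation applies to the
resulting square. -/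
theorem gPerm_mul_g_of_gt {w : Equiv.Perm (Fin n)} {i : Fin (n - 1)}
    (h : w⁻¹ (hi i) < w⁻¹ (lo i)) :
    gPerm q w * g q i = gPerm q (simple i * w)
      + ((q : R) - (↑q⁻¹ : R)) • (gPerm q w * e q i) := by
  have h1 : gPerm q (simple i * w) * g q i = gPerm q w := by
    rw [gPerm_mul_g (by simpa using h), ← mul_assoc, simple_mul_self, one_mul]
  rw [← h1, mul_assoc, g_mul_g, mul_add, mul_one, mul_smul_comm, mul_assoc, g_mul_e]

end GPerm
end BT

namespace BT

/-! ## The elements `E_{ij}` -/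

section Tie

variable {R : Type*} [CommRing R] {n : ℕ} {q : Rˣ}

theorem e_comm (i j : Fin (n - 1)) : e q i * e q j = e q j * e q i := by
  simpa [e] using mk_rel (Rel.ee (q := q) i j)

theorem e_mul_self (i : Fin (n - 1)) : e q i * e q i = e q i := by
  simpa [e] using mk_rel (Rel.e_sq (q := q) i)

theorem g_mul_e_of_distant {i j : Fin (n - 1)} (h : Distant i j) :
    g q i * e q j = e q j * g q i := by
  simpa [g, e] using mk_rel (Rel.ge_distant (q := q) i j h)

theorem e_mul_g_mul_g {i j : Fin (n - 1)} (h : Adjacent i j) :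
    e q i * g q j * g q i = g q j * g q i * e q j := by
  simpa [g, e] using mk_rel (Rel.egg (q := q) i j h)

theorem e_mul_e_mul_g {i j : Fin (n - 1)} (h : Adjacent i j) :
    e q i * e q j * g q j = g q j * e q i * e q j := by
  have h1 := mk_rel (Rel.eeg (q := q) i j h)
  have h2 := mk_rel (Rel.ege (q := q) i j h)
  simpa [g, e] using h1.trans h2

variable (q) in
/-- Conjugation by `g_i`. -/
def gConj (i : Fin (n - 1)) : ConjAct (Alg n q)ˣ := ConjAct.toConjAct (gUnit q i)

theorem gConj_smul (i : Fin (n - 1)) (x : Alg n q) :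
    gConj q i • x = (gUnit q i).val * x * (gUnit q i)⁻¹.val := by
  rw [ConjAct.units_smul_def]; rfl

theorem gConj_smul_eq_iff {i : Fin (n - 1)} {x y : Alg n q} :
    gConj q i • x = y ↔ g q i * x = y * g q i := by
  rw [gConj_smul, Units.mul_inv_eq_iff_eq_mul]; rfl

theorem gConj_comm {i j : Fin (n - 1)} (h : Distant i j) :
    gConj q i * gConj q j = gConj q j * gConj q i := by
  rw [gConj, gConj, ← ConjAct.toConjAct_mul, ← ConjAct.toConjAct_mul]
  exact congrArg _ (Units.ext (g_comm h))

theorem gConj_braid {i j : Fin (n - 1)} (h : Adjacent i j) :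
    gConj q i * gConj q j * gConj q i = gConj q j * gConj q i * gConj q j := by
  simp only [gConj, ← ConjAct.toConjAct_mul]
  exact congrArg _ (Units.ext (g_braid h))

theorem gConj_smul_e_self (i : Fin (n - 1)) : gConj q i • e q i = e q i :=
  gConj_smul_eq_iff.2 (g_mul_e i)

theorem gConj_smul_e_of_distant {i j : Fin (n - 1)} (h : Distant i j) :
    gConj q i • e q j = e q j :=
  gConj_smul_eq_iff.2 (g_mul_e_of_distant h)

theorem gConj_smul_gConj_smul_e {i j : Fin (n - 1)} (h : Adjacent i j) :
    gConj q j • gConj q i • e q j = e q i := by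
  rw [← mul_smul, gConj, gConj, ← ConjAct.toConjAct_mul, ConjAct.units_smul_def,
    Units.mul_inv_eq_iff_eq_mul]
  change g q j * g q i * e q j = e q i * (g q j * g q i)
  rw [← mul_assoc, e_mul_g_mul_g h]

/-- Although g_i² is not 1, it differs from 1 by a multiple of e_i g_i, which commutes with e_j.
This is why conjugation acts on the E_{ab} through the symmetric group and not only through the
braid group. -/
theorem gConj_smul_gConj_smul_e_self {i j : Fin (n - 1)} (h : Adjacent i j) :
    gConj q i • gConj q i • e q j = e q j := by
  rw [← mul_smul, gConj, ← ConjAct.toConjAct_mul, ConjAct.units_smul_def,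
    Units.mul_inv_eq_iff_eq_mul]
  change g q i * g q i * e q j = e q j * (g q i * g q i)
  rw [g_mul_g, add_mul, mul_add, one_mul, mul_one, smul_mul_assoc, mul_smul_comm, ← mul_assoc,
    e_mul_e_mul_g h.symm, ← g_mul_e, mul_assoc, mul_assoc, e_comm i j]

/-- For j = i + 1 these are the two ways to reach E_{i,i+2}: from e_i by moving the right end, or
from e_{i+1} by moving the left end. -/
theorem gConj_smul_e_comm {i j : Fin (n - 1)} (h : Adjacent i j) :
    gConj q j • e q i = gConj q i • e q j := by
  apply smul_left_cancel (gConj q i)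
  rw [gConj_smul_gConj_smul_e h.symm, gConj_smul_gConj_smul_e_self h]

variable (q) in
/-- The element `E_{ab}` for arbitrary positions, equal to `1` for `a = b`. -/
def tie (a b : Fin n) : Alg n q :=
  if h : a < b then EPair q a b h else if h : b < a then EPair q b a h else 1

theorem tie_comm (a b : Fin n) : tie q a b = tie q b a := by
  rcases lt_trichotomy a b with h | h | h
  · simp [tie, h, h.not_gt]
  · rw [h]
  · simp [tie, h, h.not_gt]

@[simp] theorem tie_self (a : Fin n) : tie q a a = 1 := by simp [tie]

theorem tie_of_lt {a b : Fin n} (h : a < b) : tie q a b = EPair q a b h := by simp [tie, h]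

theorem EAux_congr {k k' i i' : ℕ} (hk : k = k') (hi : i = i') (h : i + k + 1 < n)
    (h' : i' + k' + 1 < n) : EAux q k i h = EAux q k' i' h' := by
  subst hk hi; rfl

theorem tie_lo_hi (i : Fin (n - 1)) : tie q (lo i) (hi i) = e q i := by
  rw [tie_of_lt (lo_lt_hi i), EPair,
    EAux_congr (k' := 0) (i' := lo i) (by simp) rfl _ (by simp; omega), EAux]
  rfl

theorem gConj_smul_tie_hi {i : Fin (n - 1)} {b : Fin n} (h : hi i < b) :
    gConj q i • tie q (hi i) b = tie q (lo i) b := by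
  have h' : (i : ℕ) + 1 < b := h
  rw [tie_of_lt h, tie_of_lt ((lo_lt_hi i).trans h), EPair, EPair, gConj_smul,
    EAux_congr (k := (b : ℕ) - (lo i : Fin n) - 1) (k' := (b - (hi i : Fin n) - 1) + 1)
      (i' := lo i) (by simp only [lo_val, hi_val]; omega) rfl _
      (by simp only [hi_val, lo_val]; omega), EAux]
  rfl

theorem exists_lo_eq {a b : Fin n} (h : a < b) : ∃ i, lo i = a :=
  ⟨⟨a, by have := b.2; rw [Fin.lt_def] at h; omega⟩, rfl⟩

theorem exists_hi_eq {a b : Fin n} (h : a < b) : ∃ i, hi i = b := by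
  rw [Fin.lt_def] at h
  exact ⟨⟨b - 1, by omega⟩, Fin.ext (by simp only [hi_val]; omega)⟩

/-- Induction on b - a. For b = a + 1 the defining relations suffice. For larger distance the
recursion writes E_{ab} as the g_a-conjugate of E_{a+1,b}, and the conjugation by g_j is moved past
that by g_a, using commutation or the braid relation; j = a needs the square of the conjugation by
g_a to be trivial on E_{a+1,b}. -/
theorem gConj_smul_tie_of_lt {a b : Fin n} (h : a < b) (j : Fin (n - 1)) :
    gConj q j • tie q a b = tie q (simple j a) (simple j b) := by
  induction hm : (b : ℕ) - a using Nat.strong_induction_on generalizing a b j with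
  | _ m ih =>
  obtain ⟨i, rfl⟩ := exists_lo_eq h
  have hlt : (i : ℕ) < b := h
  simp only [lo_val] at hm
  have sfix : ∀ {j : Fin (n - 1)} {c : Fin n}, (c : ℕ) ≠ j → (c : ℕ) ≠ j + 1 →
      simple j c = c := fun h1 h2 ↦
    simple_of_ne (fun h ↦ h1 (congrArg Fin.val h)) fun h ↦ h2 (congrArg Fin.val h)
  rcases (show (b : ℕ) = i + 1 ∨ (i : ℕ) + 1 < b by omega) with hb | hb
  · obtain rfl : b = hi i := Fin.ext hb
    rw [tie_lo_hi]
    rcases eq_or_adjacent_or_distant i j with rfl | hij | hij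
    · rw [simple_lo, simple_hi, tie_comm, tie_lo_hi, gConj_smul_e_self]
    · rcases hij with hij | hij
      · have h1 : hi i = lo j := Fin.ext hij
        rw [sfix (c := lo i) (by simp; omega) (by simp; omega), h1, simple_lo,
          ← gConj_smul_tie_hi (by rw [h1]; exact lo_lt_hi j), h1, tie_lo_hi,
          gConj_smul_e_comm (.inl hij)]
      · have h1 : lo i = hi j := Fin.ext hij.symm
        rw [sfix (c := hi i) (by simp; omega) (by simp; omega), h1, simple_hi,
          ← gConj_smul_tie_hi (by rw [← h1]; exact lo_lt_hi i), ← h1, tie_lo_hi]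
    · rw [gConj_smul_e_of_distant (Or.symm hij), sfix, sfix, tie_lo_hi]
      all_goals simp only [lo_val, hi_val]; rcases hij with h | h <;> omega
  · have hcb : hi i < b := hb
    rw [← gConj_smul_tie_hi hcb]
    rcases eq_or_adjacent_or_distant i j with rfl | hij | hij
    · rw [simple_lo, sfix (c := b) (by omega) (by omega)]
      rcases (show (b : ℕ) = i + 1 + 1 ∨ (i : ℕ) + 1 + 1 < b by omega) with hb' | hb'
      · obtain ⟨j, rfl⟩ := exists_hi_eq hcb
        simp only [hi_val] at hb'
        have h1 : hi i = lo j := Fin.ext (by simp; omega)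
        rw [h1, tie_lo_hi, gConj_smul_gConj_smul_e_self]
        left; omega
      · obtain ⟨k, rfl⟩ := exists_hi_eq hcb
        simp only [hi_val] at hb' hm
        have hk : hi i < lo k := by rw [Fin.lt_def]; simp; omega
        -- For j = i and b > i + 2 the right end is peeled off as well: conjugation by g_k commutes
        -- with that by g_i, and on the shorter E_{i+1,b-1} two applications of the induction
        -- hypothesis give the trivial square.
        have e1 : tie q (hi i) (hi k) = gConj q k • tie q (hi i) (lo k) := by
          rw [ih _ (by simp; omega) hk k rfl, simple_lo, sfix] <;> simp <;> omega
        have e2 : gConj q i • gConj q i • tie q (hi i) (lo k) = tie q (hi i) (lo k) := by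
          rw [ih _ (by simp; omega) hk i rfl, simple_hi,
            sfix (c := lo k) (by simp; omega) (by simp; omega),
            ih _ (by simp; omega) ((lo_lt_hi i).trans hk) i rfl, simple_lo,
            sfix (c := lo k) (by simp; omega) (by simp; omega)]
        have hd : Distant i k := .inl (by omega)
        rw [e1, smul_smul (gConj q i) (gConj q k), gConj_comm hd, mul_smul,
          smul_smul (gConj q i) (gConj q k), gConj_comm hd, mul_smul, e2]
    · rcases hij with hij | hij
      · have h1 : hi i = lo j := Fin.ext hij
        rcases (show (b : ℕ) = j + 1 ∨ (j : ℕ) + 1 < b by omega) with hb' | hb'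
        · obtain rfl : b = hi j := Fin.ext hb'
          rw [h1, tie_lo_hi, gConj_smul_gConj_smul_e (.inl hij), simple_hi, sfix, ← h1, tie_lo_hi]
            <;> simp <;> omega
        -- For j = i + 1 < b - 1, E_{ib} comes from E_{i+2,b} by conjugation with g_i g_j. The braid
        -- relation turns g_j g_i g_j into g_i g_j g_i, whose last factor g_i fixes E_{i+2,b}.
        · have hjb : hi j < b := hb'
          rw [sfix (c := b) (by omega) (by omega),
            sfix (c := lo i) (by simp; omega) (by simp; omega), ← gConj_smul_tie_hi hcb, h1,
            ← gConj_smul_tie_hi hjb, smul_smul, smul_smul, gConj_braid (.inr hij), mul_smul,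
            ih _ (by simp; omega) hjb i rfl, sfix (c := b) (by omega) (by omega),
            sfix (c := hi j) (by simp; omega) (by simp; omega), mul_smul]
      · have h1 : lo i = hi j := Fin.ext hij.symm
        rw [gConj_smul_tie_hi hcb, sfix (c := b) (by omega) (by omega), h1, simple_hi,
          gConj_smul_tie_hi (by rw [← h1]; exact h)]
    · rw [smul_smul, gConj_comm (Or.symm hij), mul_smul, ih _ (by simp; omega) hcb j rfl,
        sfix (c := hi i) (by simp; rcases hij with h | h <;> omega)
          (by simp; rcases hij with h | h <;> omega),
        sfix (c := lo i) (by simp; rcases hij with h | h <;> omega)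
          (by simp; rcases hij with h | h <;> omega), gConj_smul_tie_hi]
      rw [Fin.lt_def, simple_val, hi_val]
      rcases hij with h | h <;> split_ifs <;> omega

theorem gConj_smul_tie (j : Fin (n - 1)) (a b : Fin n) :
    gConj q j • tie q a b = tie q (simple j a) (simple j b) := by
  rcases lt_trichotomy a b with h | rfl | h
  · exact gConj_smul_tie_of_lt h j
  · simp
  · rw [tie_comm, gConj_smul_tie_of_lt h, tie_comm]

theorem g_mul_tie (j : Fin (n - 1)) (a b : Fin n) :
    g q j * tie q a b = tie q (simple j a) (simple j b) * g q j :=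
  gConj_smul_eq_iff.1 (gConj_smul_tie j a b)

theorem gPerm_mul_tie (w : Equiv.Perm (Fin n)) (a b : Fin n) :
    gPerm q w * tie q a b = tie q (w⁻¹ a) (w⁻¹ b) * gPerm q w := by
  have key : ∀ l : List (Fin (n - 1)), (l.map (g q)).prod * tie q a b =
      tie q ((wordPerm l)⁻¹ a) ((wordPerm l)⁻¹ b) * (l.map (g q)).prod := by
    intro l
    induction l with
    | nil => simp [wordPerm]
    | cons i l ih =>
      rw [List.map_cons, List.prod_cons, mul_assoc, ih, ← mul_assoc, g_mul_tie, mul_assoc]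
      simp [wordPerm]
  have := key (reducedWord w)
  rwa [wordPerm_reducedWord] at this

/-! ### Relations among the E_{ab}, transported to consecutive positions. -/

theorem exists_smul_tie (w : Equiv.Perm (Fin n)) :
    ∃ c : ConjAct (Alg n q)ˣ, ∀ a b, c • tie q a b = tie q (w a) (w b) := by
  obtain ⟨l, rfl⟩ := exists_wordPerm w
  induction l with
  | nil => exact ⟨1, fun a b ↦ by simp [wordPerm]⟩
  | cons i l ih =>
    obtain ⟨c, hc⟩ := ih
    exact ⟨c * gConj q i, fun a b ↦ by rw [mul_smul, gConj_smul_tie, hc]; rfl⟩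

/-- High transitivity of the symmetric group: distinct positions can be moved to the initial ones,
where the E_{ab} in question are generators or a single conjugate of one. Conjugation is injective,
so relations checked there hold everywhere. -/
theorem exists_perm_apply_eq {k : ℕ} (f : Fin k → Fin n) (hf : Function.Injective f) (hk : k ≤ n) :
    ∃ w : Equiv.Perm (Fin n), ∀ i, w (f i) = Fin.castLE hk i := by
  obtain ⟨w, hw⟩ := (Equiv.Perm.isMultiplyPretransitive (Fin n) k).exists_smul_eq ⟨f, hf⟩
    (Fin.castLEEmb hk)
  exact ⟨w, fun i ↦ congrArg (fun x : Fin k ↪ Fin n ↦ x i) hw⟩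

theorem le_of_injective {k : ℕ} {f : Fin k → Fin n} (hf : Function.Injective f) : k ≤ n := by
  simpa using Fintype.card_le_of_injective f hf

theorem tie_mul_self (a b : Fin n) : tie q a b * tie q a b = tie q a b := by
  by_cases hab : a = b
  · simp [hab]
  have hf : Function.Injective ![a, b] := by
    intro i j; fin_cases i <;> fin_cases j <;> simp [hab, Ne.symm hab]
  have hn := le_of_injective hf
  obtain ⟨w, hw⟩ := exists_perm_apply_eq _ hf hn
  obtain ⟨c, hc⟩ := exists_smul_tie (q := q) w
  apply smul_left_cancel c
  have h0 : w a = lo ⟨0, by omega⟩ := hw 0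
  have h1 : w b = hi ⟨0, by omega⟩ := hw 1
  rw [smul_mul', hc, h0, h1, tie_lo_hi, e_mul_self]

/-- Relations between `E_{ab}`, `E_{bc}` and `E_{ac}` need only be checked in one case. -/
theorem tie_triple {a b c : Fin n} (hab : a ≠ b) (hac : a ≠ c) (hbc : b ≠ c) :
    tie q a b * tie q b c = tie q b c * tie q a b ∧
      tie q a b * tie q b c = tie q a b * tie q a c := by
  have hf : Function.Injective ![a, b, c] := by
    intro i j; fin_cases i <;> fin_cases j <;> simp [*, Ne.symm]
  have hn := le_of_injective hf
  have k0 : 0 < n - 1 := by omega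
  have k1 : 1 < n - 1 := by omega
  obtain ⟨w, hw⟩ := exists_perm_apply_eq _ hf hn
  obtain ⟨x, hx⟩ := exists_smul_tie (q := q) w
  have h0 : w a = lo ⟨0, k0⟩ := hw 0
  have h1 : w b = hi ⟨0, k0⟩ := hw 1
  have h1' : w b = lo ⟨1, k1⟩ := hw 1
  have h2 : w c = hi ⟨1, k1⟩ := hw 2
  have e1 : tie q (w a) (w b) = e q ⟨0, k0⟩ := by rw [h0, h1, tie_lo_hi]
  have e2 : tie q (w b) (w c) = e q ⟨1, k1⟩ := by rw [h1', h2, tie_lo_hi]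
  have e3 : tie q (w a) (w c) = gConj q ⟨0, k0⟩ • e q ⟨1, k1⟩ := by
    rw [h0, ← gConj_smul_tie_hi, ← h1, e2]
    rw [h2, Fin.lt_def]; simp
  have hadj : Adjacent (⟨1, k1⟩ : Fin (n - 1)) ⟨0, k0⟩ := .inr rfl
  constructor <;> apply smul_left_cancel x <;> rw [smul_mul', smul_mul', hx, hx, e1, e2]
  · exact e_comm _ _
  -- Writing the third element as g₁ e₂ g₁⁻¹ and clearing the inverse leaves e₁ e₂ g₁ = e₁ g₁ e₂, a
  -- consequence of the mixed relations between adjacent generators.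
  · rw [hx, e3, gConj_smul, ← mul_assoc, ← mul_assoc, Units.eq_mul_inv_iff_mul_eq]
    change _ * _ * g q _ = e q _ * g q _ * e q _
    rw [e_comm, e_mul_e_mul_g hadj, ← g_mul_e, mul_assoc, mul_assoc, e_comm]

theorem tie_mul_tie_of_disjoint {a b c d : Fin n} (hab : a ≠ b) (hac : a ≠ c) (had : a ≠ d)
    (hbc : b ≠ c) (hbd : b ≠ d) (hcd : c ≠ d) :
    tie q a b * tie q c d = tie q c d * tie q a b := by
  have hf : Function.Injective ![a, b, c, d] := by
    intro i j; fin_cases i <;> fin_cases j <;> simp [*, Ne.symm]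
  have hn := le_of_injective hf
  obtain ⟨w, hw⟩ := exists_perm_apply_eq _ hf hn
  obtain ⟨x, hx⟩ := exists_smul_tie (q := q) w
  have h0 : w a = lo ⟨0, by omega⟩ := hw 0
  have h1 : w b = hi ⟨0, by omega⟩ := hw 1
  have h2 : w c = lo ⟨2, by omega⟩ := hw 2
  have h3 : w d = hi ⟨2, by omega⟩ := hw 3
  apply smul_left_cancel x
  rw [smul_mul', smul_mul', hx, hx, h0, h1, h2, h3, tie_lo_hi, tie_lo_hi, e_comm]

theorem tie_mul_tie_comm (a b c d : Fin n) :
    tie q a b * tie q c d = tie q c d * tie q a b := by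
  have key : ∀ a b c : Fin n, tie q a b * tie q b c = tie q b c * tie q a b := by
    intro a b c
    by_cases hab : a = b
    · simp [hab]
    by_cases hbc : b = c
    · simp [hbc]
    by_cases hac : a = c
    · rw [hac, tie_comm]
    exact (tie_triple hab hac hbc).1
  by_cases hbc : b = c
  · rw [hbc, key]
  by_cases hac : a = c
  · rw [hac, tie_comm c b, key]
  by_cases hbd : b = d
  · rw [hbd, tie_comm c d, key]
  by_cases had : a = d
  · rw [had, tie_comm d b, tie_comm c d, key]
  by_cases hab : a = b
  · simp [hab]
  by_cases hcd : c = d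
  · simp [hcd]
  exact tie_mul_tie_of_disjoint hab hac had hbc hbd hcd

theorem tie_mul_tie_trans (a b c : Fin n) :
    tie q a b * tie q b c = tie q a b * tie q a c := by
  by_cases hab : a = b
  · simp [hab]
  by_cases hbc : b = c
  · simp [hbc, tie_mul_self]
  by_cases hac : a = c
  · rw [hac, tie_self, mul_one, tie_comm b c, tie_mul_self]
  exact (tie_triple hab hac hbc).2

end Tie
end BT

namespace BT

/-! ## Set partitions -/

section SetPartition

variable {n : ℕ}

theorem SetPartition.le_iff {A B : SetPartition n} :
    A ≤ B ↔ ∀ a b, A.part a = A.part b → B.part a = B.part b := by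
  constructor
  · intro h a b hab
    obtain ⟨c, hc, hle⟩ := h (A.part_mem.2 (Finset.mem_univ a))
    rw [B.part_eq_of_mem hc (hle (A.mem_part (Finset.mem_univ a))),
      B.part_eq_of_mem hc (hle (hab ▸ A.mem_part (Finset.mem_univ b)))]
  · intro h p hp
    obtain ⟨a, ha⟩ := A.nonempty_of_mem_parts hp
    refine ⟨B.part a, B.part_mem.2 (Finset.mem_univ a), fun b hb ↦ ?_⟩
    rw [h a b (by rw [A.part_eq_of_mem hp ha, A.part_eq_of_mem hp hb])]
    exact B.mem_part (Finset.mem_univ b)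

/-- The set partition into the nonempty fibres of a function. -/
def kerPart {β : Type*} (f : Fin n → β) : SetPartition n :=
  letI s : Setoid (Fin n) := Setoid.ker f
  haveI : DecidableRel s.r := fun _ _ ↦ Classical.propDecidable _
  Finpartition.ofSetoid s

theorem mem_part_kerPart {β : Type*} {f : Fin n → β} {a b : Fin n} :
    b ∈ (kerPart f).part a ↔ f a = f b := by
  let : DecidableRel (Setoid.ker f) := fun _ _ ↦ Classical.propDecidable _
  exact Finpartition.mem_part_ofSetoid_iff_rel (s := Setoid.ker f)

theorem part_kerPart_eq_iff {β : Type*} {f : Fin n → β} {a b : Fin n} :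
    (kerPart f).part a = (kerPart f).part b ↔ f a = f b := by
  rw [← Finpartition.mem_part_iff_part_eq_part _ (Finset.mem_univ a) (Finset.mem_univ b),
    mem_part_kerPart, eq_comm]

theorem mem_parts_iff {A : SetPartition n} {p : Finset (Fin n)} :
    p ∈ A.parts ↔ ∃ a, A.part a = p := by
  constructor
  · intro hp
    obtain ⟨a, ha⟩ := A.nonempty_of_mem_parts hp
    exact ⟨a, A.part_eq_of_mem hp ha⟩
  · rintro ⟨a, rfl⟩
    exact A.part_mem.2 (Finset.mem_univ a)

theorem parts_kerPart_comp {β : Type*} (f : Fin n → β) (σ : Equiv.Perm (Fin n)) :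
    (kerPart (f ∘ σ)).parts =
      (kerPart f).parts.map (Finset.mapEmbedding σ.symm.toEmbedding).toEmbedding := by
  have h : ∀ a, (kerPart (f ∘ σ)).part a =
      ((kerPart f).part (σ a)).map σ.symm.toEmbedding := by
    intro a
    ext b
    rw [mem_part_kerPart, Finset.mem_map_equiv, mem_part_kerPart]
    rfl
  ext p
  simp only [mem_parts_iff, Finset.mem_map, h]
  constructor
  · rintro ⟨a, rfl⟩
    exact ⟨_, ⟨σ a, rfl⟩, rfl⟩
  · rintro ⟨_, ⟨a, rfl⟩, rfl⟩
    exact ⟨σ.symm a, by simp⟩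

/-- A permutation of positions carries blocks to blocks of the same size; this lets the type of a
shape be read off from any multitableau of that shape. -/
theorem isOfType_kerPart_comp {β : Type*} (f : Fin n → β) (σ : Equiv.Perm (Fin n))
    (α : n.Partition) : IsOfType (kerPart (f ∘ σ)) α ↔ IsOfType (kerPart f) α := by
  rw [IsOfType, IsOfType, parts_kerPart_comp, Finset.map_val, Multiset.map_map]
  simp [Function.comp_def]

/-- The set partition obtained by joining the blocks of `a` and `b`. -/
def joinBlocks (A : SetPartition n) (a b : Fin n) : SetPartition n :=
  kerPart fun x ↦ if A.part x = A.part b then A.part a else A.part x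

/-- The universal property of the join, which is all that the Möbius arguments use. -/
theorem joinBlocks_le_iff {A C : SetPartition n} {a b : Fin n} :
    joinBlocks A a b ≤ C ↔ A ≤ C ∧ C.part a = C.part b := by
  simp only [SetPartition.le_iff, joinBlocks, part_kerPart_eq_iff]
  constructor
  · exact fun h ↦ ⟨fun x y hxy ↦ h x y (by rw [hxy]), h a b (by simp)⟩
  · rintro ⟨h, hab⟩ x y hxy
    split_ifs at hxy with hx hy hy
    · exact h x y (hx.trans hy.symm)
    · exact ((h _ _ hx).trans hab.symm).trans (h _ _ hxy)
    · exact (h _ _ hxy).trans (hab.trans (h _ _ hy).symm)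
    · exact h x y hxy

end SetPartition

/-! ## The idempotents -/

section Idempotent

variable {R : Type*} [CommRing R] {n : ℕ} {q : Rˣ}

theorem EPart_eq (A : SetPartition n) :
    EPart q A = ((List.finRange n ×ˢ List.finRange n).map fun p ↦
      if p.1 < p.2 ∧ A.part p.1 = A.part p.2 then tie q p.1 p.2 else 1).prod := by
  rw [EPart]
  congr 2
  funext p
  split_ifs with h
  · rw [tie_of_lt h.1]
  · rfl

theorem list_prod_mul_of_mem {M ι : Type*} [Monoid M] {f : ι → M}
    (hcomm : ∀ i j, f i * f j = f j * f i) (hidem : ∀ i, f i * f i = f i) {l : List ι} {i : ι}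
    (hi : i ∈ l) : (l.map f).prod * f i = (l.map f).prod := by
  induction l with
  | nil => simp at hi
  | cons j l ih =>
    rw [List.map_cons, List.prod_cons]
    rcases List.mem_cons.1 hi with rfl | hi
    · have : Commute (l.map f).prod (f i) := by
        apply Commute.list_prod_left
        rintro x hx
        obtain ⟨j, -, rfl⟩ := List.mem_map.1 hx
        exact hcomm j i
      rw [mul_assoc, this.eq, ← mul_assoc, hidem]
    · rw [mul_assoc, ih hi]

theorem EPart_mul_tie_of_rel {A : SetPartition n} {a b : Fin n} (h : A.part a = A.part b) :
    EPart q A * tie q a b = EPart q A := by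
  wlog hab : a < b generalizing a b
  · rcases (not_lt.1 hab).eq_or_lt with rfl | h'
    · simp
    · rw [tie_comm, this h.symm h']
  rw [EPart_eq]
  set f : Fin n × Fin n → Alg n q := fun p ↦
    if p.1 < p.2 ∧ A.part p.1 = A.part p.2 then tie q p.1 p.2 else 1 with hf
  have h1 : tie q a b = f (a, b) := by simp [hf, hab, h]
  rw [h1]
  apply list_prod_mul_of_mem
  · intro x y
    simp only [hf]
    split_ifs <;> simp [tie_mul_tie_comm x.1]
  · intro x
    simp only [hf]
    split_ifs <;> simp [tie_mul_self]
  · simp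

theorem commute_EPart_tie (A : SetPartition n) (a b : Fin n) :
    Commute (EPart q A) (tie q a b) := by
  rw [EPart_eq]
  apply Commute.list_prod_left
  rintro x hx
  obtain ⟨p, -, rfl⟩ := List.mem_map.1 hx
  split_ifs
  · exact tie_mul_tie_comm _ _ _ _
  · exact Commute.one_left _

/-! ### Joint eigenvectors of the E_{ab}. -/

section Module

variable {M : Type*} [AddCommGroup M] [Module (Alg n q)ᵐᵒᵖ M] {K : SetPartition n} {z : M}

open Classical in
-- The hypothesis makes `z` a joint eigenvector of the E_{ab} with eigenvalues prescribed by `K`. So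
-- E_B fixes `z` if every pair joined by `B` is joined by `K`, and otherwise some factor kills it.
theorem op_EPart_smul
    (hz : ∀ a b, op (tie q a b) • z = if K.part a = K.part b then z else 0)
    (B : SetPartition n) : op (EPart q B) • z = if B ≤ K then z else 0 := by
  have key : ∀ l : List (Fin n × Fin n), op ((l.map fun p ↦
      if p.1 < p.2 ∧ B.part p.1 = B.part p.2 then tie q p.1 p.2 else 1).prod) • z =
      if ∀ p ∈ l, p.1 < p.2 → B.part p.1 = B.part p.2 → K.part p.1 = K.part p.2 then z else 0 := by
    intro l
    induction l with
    | nil => simp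
    | cons p l ih =>
      rw [List.map_cons, List.prod_cons, MulOpposite.op_mul, mul_smul]
      by_cases h : p.1 < p.2 ∧ B.part p.1 = B.part p.2
      · rw [if_pos h, hz]
        by_cases h' : K.part p.1 = K.part p.2
        · rw [if_pos h', ih]
          simp [h']
        · rw [if_neg h', smul_zero, if_neg]
          intro h''
          exact h' (h'' p (by simp) h.1 h.2)
      · rw [if_neg h, MulOpposite.op_one, one_smul, ih]
        congr 1
        rw [List.forall_mem_cons]
        simp only [eq_iff_iff, iff_and_self]
        intro _ h1 h2
        exact absurd ⟨h1, h2⟩ h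
  rw [EPart_eq, key]
  congr 1
  rw [SetPartition.le_iff, eq_iff_iff]
  constructor
  · intro h a b hab
    rcases lt_trichotomy a b with h' | rfl | h'
    · exact h (a, b) (by simp) h' hab
    · rfl
    · exact (h (b, a) (by simp) h' hab.symm).symm
  · exact fun h p _ _ hp ↦ h _ _ hp

open Classical in
-- The scalar is the sum of μ(B, C) over the interval from `B` to `K`, which vanishes unless `B =
-- K`.
theorem op_idem_smul
    (hz : ∀ a b, op (tie q a b) • z = if K.part a = K.part b then z else 0)
    (B : SetPartition n) : op (idem q B) • z = if B = K then z else 0 := by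
  have h1 : op (idem q B) • z = ∑ C with B ≤ C, IncidenceAlgebra.mu ℤ B C •
      (if C ≤ K then z else 0) := by
    rw [idem, Finset.op_sum, Finset.sum_smul]
    refine Finset.sum_congr rfl fun C _ ↦ ?_
    rw [MulOpposite.op_smul, smul_assoc, op_EPart_smul hz]
  have h2 : (∑ C with B ≤ C, IncidenceAlgebra.mu ℤ B C • (if C ≤ K then z else 0)) =
      (∑ C ∈ Finset.Icc B K, IncidenceAlgebra.mu ℤ B C) • z := by
    simp only [smul_ite, smul_zero]
    rw [← Finset.sum_filter, Finset.sum_smul, Finset.filter_filter]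
    refine Finset.sum_congr ?_ fun _ _ ↦ rfl
    ext C; simp
  rw [h1, h2, IncidenceAlgebra.sum_Icc_mu_right]
  split_ifs <;> simp

open Classical in
theorem op_idemType_smul
    (hz : ∀ a b, op (tie q a b) • z = if K.part a = K.part b then z else 0)
    (α : n.Partition) : op (idemType q α) • z = if IsOfType K α then z else 0 := by
  rw [idemType, Finset.op_sum, Finset.sum_smul]
  simp only [op_idem_smul hz]
  rw [Finset.sum_ite_eq']
  simp

end Module

theorem mul_EPart_of_absorb {x : Alg n q} {A : SetPartition n}
    (h : ∀ a b, A.part a = A.part b → x * tie q a b = x) : x * EPart q A = x := by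
  rw [EPart_eq]
  generalize List.finRange n ×ˢ List.finRange n = l
  induction l with
  | nil => simp
  | cons p l ih =>
    rw [List.map_cons, List.prod_cons, ← mul_assoc]
    split_ifs with hp
    · rw [h _ _ hp.2, ih]
    · rw [mul_one, ih]

/-- By the transitivity relation, the left side X absorbs every E_{xy} with x and y in one block of
the join, so X E_join = X. Also E_join absorbs X because the join is coarser. As X and E_join
commute, they are equal. -/
theorem EPart_mul_tie (A : SetPartition n) (a b : Fin n) :
    EPart q A * tie q a b = EPart q (joinBlocks A a b) := by
  have hA := joinBlocks_le_iff.1 (le_refl (joinBlocks A a b))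
  have hcomm : EPart q A * EPart q (joinBlocks A a b) =
      EPart q (joinBlocks A a b) * EPart q A := by
    rw [EPart_eq (joinBlocks A a b)]
    apply (Commute.list_prod_right _ _ ?_).eq
    rintro x hx
    obtain ⟨p, -, rfl⟩ := List.mem_map.1 hx
    split_ifs
    · exact commute_EPart_tie _ _ _
    · exact Commute.one_right _
  have h1 : EPart q (joinBlocks A a b) * (EPart q A * tie q a b) = EPart q (joinBlocks A a b) := by
    rw [← mul_assoc, mul_EPart_of_absorb, EPart_mul_tie_of_rel hA.2]
    exact fun x y h ↦ EPart_mul_tie_of_rel (SetPartition.le_iff.1 hA.1 x y h)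
  set X := EPart q A * tie q a b with hX
  have hXA : ∀ x y, A.part x = A.part y → X * tie q x y = X := by
    intro x y hxy
    rw [hX, mul_assoc, tie_mul_tie_comm, ← mul_assoc, EPart_mul_tie_of_rel hxy]
  have hXab : X * tie q a b = X := by rw [hX, mul_assoc, tie_mul_self]
  have trans : ∀ {x y z}, X * tie q x y = X → X * tie q y z = X → X * tie q x z = X := by
    intro x y z h h'
    rw [← h, mul_assoc, ← tie_mul_tie_trans, ← mul_assoc, h, h']
  have symm : ∀ {x y}, X * tie q x y = X → X * tie q y x = X := by
    intro x y h
    rwa [tie_comm]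
  have h2 : X * EPart q (joinBlocks A a b) = X := by
    apply mul_EPart_of_absorb
    intro x y hxy
    rw [joinBlocks, part_kerPart_eq_iff] at hxy
    split_ifs at hxy with hx hy hy
    · exact hXA x y (hx.trans hy.symm)
    · exact trans (trans (hXA _ _ hx) (symm hXab)) (hXA _ _ hxy)
    · exact trans (hXA _ _ hxy) (trans hXab (hXA _ _ hy.symm))
    · exact hXA x y hxy
  have hc : Commute X (EPart q (joinBlocks A a b)) :=
    Commute.mul_left hcomm (commute_EPart_tie _ _ _).symm
  rw [← h2, hc.eq, h1]

open Classical in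
-- Möbius inversion of the definition of `idem`.
theorem EPart_eq_sum_idem (A : SetPartition n) : EPart q A = ∑ C with A ≤ C, idem q C := by
  simp only [idem, Finset.sum_filter]
  have h1 : ∀ C : SetPartition n, (if A ≤ C then
      ∑ B, if C ≤ B then IncidenceAlgebra.mu ℤ C B • EPart q B else 0 else 0) =
      ∑ B, if A ≤ C ∧ C ≤ B then IncidenceAlgebra.mu ℤ C B • EPart q B else 0 := by
    intro C
    by_cases h : A ≤ C <;> simp [h]
  rw [Finset.sum_congr rfl fun C _ ↦ h1 C, Finset.sum_comm]
  have h2 : ∀ B : SetPartition n, (∑ C, if A ≤ C ∧ C ≤ B then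
      IncidenceAlgebra.mu ℤ C B • EPart q B else 0) = if A = B then EPart q B else 0 := by
    intro B
    have : (∑ C ∈ Finset.Icc A B, IncidenceAlgebra.mu ℤ C B) • EPart q B =
        if A = B then EPart q B else 0 := by
      rw [IncidenceAlgebra.sum_Icc_mu_left]; split_ifs <;> simp
    rw [← this, Finset.sum_smul, ← Finset.sum_filter]
    refine Finset.sum_congr ?_ fun _ _ ↦ rfl
    ext C; simp
  rw [Finset.sum_congr rfl fun B _ ↦ h2 B]
  simp

open Classical in
-- Induction downwards from the coarsest partition. If `A` separates a and b, expand both sides of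
-- E_A E_{ab} = E_join in the 𝔼_C. By induction the terms with C > A on the left already add up to
-- the right side, which leaves 𝔼_A E_{ab} = 0.
theorem idem_mul_tie (A : SetPartition n) (a b : Fin n) :
    idem q A * tie q a b = if A.part a = A.part b then idem q A else 0 := by
  induction A using WellFoundedGT.induction with
  | ind A ih =>
  split_ifs with h
  · rw [idem, Finset.sum_mul]
    refine Finset.sum_congr rfl fun B hB ↦ ?_
    rw [smul_mul_assoc, EPart_mul_tie_of_rel]
    exact SetPartition.le_iff.1 (Finset.mem_filter.1 hB).2 a b h
  · have h1 := EPart_mul_tie (q := q) A a b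
    have hA : A ∈ ({C | A ≤ C} : Finset (SetPartition n)) := by simp
    rw [EPart_eq_sum_idem A, EPart_eq_sum_idem (joinBlocks A a b), Finset.sum_mul,
      ← Finset.add_sum_erase _ _ hA] at h1
    have h2 : ∑ C ∈ ({C | A ≤ C} : Finset (SetPartition n)).erase A, idem q C * tie q a b =
        ∑ C with joinBlocks A a b ≤ C, idem q C := by
      have : ∀ C ∈ ({C | A ≤ C} : Finset (SetPartition n)).erase A, idem q C * tie q a b =
          if C.part a = C.part b then idem q C else 0 := by
        intro C hC
        simp only [Finset.mem_erase, Finset.mem_filter, Finset.mem_univ, true_and] at hC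
        exact ih C (lt_of_le_of_ne hC.2 hC.1.symm)
      rw [Finset.sum_congr rfl this, ← Finset.sum_filter]
      refine Finset.sum_congr ?_ fun _ _ ↦ rfl
      ext C
      simp only [Finset.mem_erase, Finset.mem_filter, Finset.mem_univ, true_and,
        joinBlocks_le_iff]
      constructor
      · exact fun h ↦ ⟨h.1.2, h.2⟩
      · rintro ⟨h3, h4⟩
        refine ⟨⟨?_, h3⟩, h4⟩
        rintro rfl
        exact h h4
    rw [h2] at h1
    simpa using h1

end Idempotent
end BT

namespace BT

/-! ## Row standard multitableaux -/

section Tableaux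

variable {r n N : ℕ}

theorem node_ext {x y : Fin r ×ₗ ℕ ×ₗ ℕ} (h1 : comp x = comp y) (h2 : row x = row y)
    (h3 : col x = col y) : x = y :=
  ofLex.injective (Prod.ext h1 (ofLex.injective (Prod.ext h2 h3)))

/-- The node in component `p`, row `i` and column `c`. -/
def node (p : Fin r) (i c : ℕ) : Fin r ×ₗ ℕ ×ₗ ℕ := toLex (p, toLex (i, c))

@[simp] theorem comp_node (p : Fin r) (i c : ℕ) : comp (node p i c) = p := rfl

@[simp] theorem row_node (p : Fin r) (i c : ℕ) : row (node p i c) = i := rfl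

@[simp] theorem col_node (p : Fin r) (i c : ℕ) : col (node p i c) = c := rfl

theorem node_lt_iff {x y : Fin r ×ₗ ℕ ×ₗ ℕ} :
    x < y ↔ comp x < comp y ∨ comp x = comp y ∧ (row x < row y ∨ row x = row y ∧ col x < col y) := by
  rw [Prod.Lex.lt_iff, Prod.Lex.lt_iff]; rfl

namespace MultiComp

variable {μ : MultiComp r n}

/-- The positions `a` and `b` lie in the same row of the same component of `t`. -/
def SameRow (t : μ.Tab) (a b : Fin n) : Prop :=
  comp (t a).1 = comp (t b).1 ∧ row (t a).1 = row (t b).1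

theorem eq_of_sameRow {t : μ.Tab} {a b : Fin n} (h : SameRow t a b)
    (hc : col (t a).1 = col (t b).1) : a = b :=
  t.injective (Subtype.ext (node_ext h.1 h.2 hc))

theorem IsRowStandard.col_lt_iff {t : μ.Tab} (ht : IsRowStandard t) {a b : Fin n}
    (h : SameRow t a b) : col (t a).1 < col (t b).1 ↔ a < b := by
  refine ⟨ht a b h.1 h.2, fun hab ↦ ?_⟩
  rcases lt_trichotomy (col (t a).1) (col (t b).1) with hc | hc | hc
  · exact hc
  · exact absurd (eq_of_sameRow h hc) hab.ne
  · exact absurd (ht b a h.1.symm h.2.symm hc) hab.not_gt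

open Classical in
-- Columns are numbered from 0, so the column of an entry counts the smaller entries of its row.
-- Hence columns carry no information beyond the rows.
theorem IsRowStandard.col_eq {t : μ.Tab} (ht : IsRowStandard t) (b : Fin n) :
    col (t b).1 = ({a | a < b ∧ SameRow t a b} : Finset (Fin n)).card := by
  rw [← Finset.card_range (col (t b).1)]
  symm
  refine Finset.card_bij (fun a _ ↦ col (t a).1) ?_ ?_ ?_
  · intro a ha
    simp only [Finset.mem_filter, Finset.mem_univ, true_and] at ha
    exact Finset.mem_range.2 ((ht.col_lt_iff ha.2).2 ha.1)
  · intro a ha a' ha' h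
    simp only [Finset.mem_filter, Finset.mem_univ, true_and] at ha ha'
    exact eq_of_sameRow ⟨ha.2.1.trans ha'.2.1.symm, ha.2.2.trans ha'.2.2.symm⟩ h
  · intro c hc
    rw [Finset.mem_range] at hc
    have hm : node (comp (t b).1) (row (t b).1) c ∈ μ.diagram := by
      rw [mem_diagram]
      exact hc.trans ((μ.mem_diagram _).1 (t b).2)
    have hs : SameRow t (t.symm ⟨_, hm⟩) b := by
      simp [SameRow]
    refine ⟨t.symm ⟨_, hm⟩, ?_, by simp⟩
    simp only [Finset.mem_filter, Finset.mem_univ, true_and]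
    exact ⟨(ht.col_lt_iff hs).1 (by simpa using hc), hs⟩

/-- A row standard multitableau is determined by the contents of its rows. -/
theorem RStd.ext_of_rows {t t' : μ.RStd}
    (h : ∀ a, comp (t.1 a).1 = comp (t'.1 a).1 ∧ row (t.1 a).1 = row (t'.1 a).1) : t = t' := by
  classical
  refine Subtype.ext (Equiv.ext fun a ↦ Subtype.ext (node_ext (h a).1 (h a).2 ?_))
  rw [t.2.col_eq, t'.2.col_eq]
  congr 1
  ext x
  rw [Finset.mem_filter, Finset.mem_filter]
  simp only [SameRow, h]

theorem initialTab_lt_iff {a b : Fin n} : (μ.initialTab a).1 < (μ.initialTab b).1 ↔ a < b :=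
  (μ.diagram.orderIsoOfFin μ.card_diagram).lt_iff_lt

theorem d_apply (t : μ.Tab) (a : Fin n) : t (d t a) = μ.initialTab a := by
  simp [d]

theorem initialTab_d_inv (t : μ.Tab) (a : Fin n) : μ.initialTab ((d t)⁻¹ a) = t a := by
  rw [← d_apply t]
  exact congrArg t ((d t).apply_symm_apply a)

/-- Translates the length condition in the multiplication rules for g_{d(t)} into a comparison of
nodes of t. -/
theorem d_inv_lt_iff (t : μ.Tab) {a b : Fin n} :
    (d t)⁻¹ a < (d t)⁻¹ b ↔ (t a).1 < (t b).1 := by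
  rw [← initialTab_lt_iff (μ := μ), initialTab_d_inv, initialTab_d_inv]

theorem eq_initialTab_of_d_eq_one {t : μ.Tab} (h : d t = 1) : t = μ.initialTab :=
  Equiv.ext fun a ↦ by rw [← d_apply t, h]; rfl

theorem d_initialTab : d μ.initialTab = 1 := Equiv.ext fun a ↦ by simp [d]

theorem IsRowStandard.lt_iff {t : μ.Tab} (ht : IsRowStandard t) {a b : Fin n}
    (h : SameRow t a b) : (t a).1 < (t b).1 ↔ a < b := by
  rw [node_lt_iff, ← ht.col_lt_iff h, h.1, h.2]; simp

variable (μ) in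
/-- The initial multitableau as a row standard multitableau. -/
def initialRStd : μ.RStd :=
  ⟨μ.initialTab, fun a b h1 h2 h3 ↦ by
    rw [← initialTab_lt_iff (μ := μ), node_lt_iff]
    exact .inr ⟨h1, .inr ⟨h2, h3⟩⟩⟩

/-- Exchange two consecutive entries in different rows. -/
def RStd.swap (t : μ.RStd) (i : Fin (n - 1)) (h : ¬ SameRow t.1 (lo i) (hi i)) : μ.RStd :=
  ⟨(simple i).trans t.1, fun a b h1 h2 h3 ↦ by
    simp only [Equiv.trans_apply] at h1 h2 h3
    have h4 := t.2 _ _ h1 h2 h3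
    have h5 := simple_lt_simple (i := i) h4 (by
      rintro ⟨h6, h7⟩
      rw [h6, h7] at h1 h2
      exact h ⟨h1, h2⟩)
    simpa using h5⟩

theorem RStd.swap_apply (t : μ.RStd) (i : Fin (n - 1)) (h : ¬ SameRow t.1 (lo i) (hi i))
    (a : Fin n) : (t.swap i h).1 a = t.1 (simple i a) := rfl

theorem RStd.d_swap (t : μ.RStd) (i : Fin (n - 1)) (h : ¬ SameRow t.1 (lo i) (hi i)) :
    d (t.swap i h).1 = simple i * d t.1 := by
  refine Equiv.ext fun a ↦ (t.swap i h).1.injective ?_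
  rw [d_apply, swap_apply, Equiv.Perm.mul_apply, simple_simple, d_apply]

/-- Every row standard multitableau is obtained from the initial one by exchanging consecutive
entries that are in order. -/
theorem RStd.induction {P : μ.RStd → Prop} (init : P μ.initialRStd)
    (step : ∀ (t : μ.RStd) (i : Fin (n - 1)) (h : ¬ SameRow t.1 (lo i) (hi i)),
      (t.1 (lo i)).1 < (t.1 (hi i)).1 → P t → P (t.swap i h)) (t : μ.RStd) : P t := by
  induction hk : len (d t.1) using Nat.strong_induction_on generalizing t with
  | _ k ih =>
  by_cases hd : d t.1 = 1
  · have : t = μ.initialRStd := Subtype.ext (eq_initialTab_of_d_eq_one hd)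
    rwa [this]
  -- At such a descent i + 1 precedes i in the order of the nodes. In a row standard multitableau
  -- the two then lie in different rows, and exchanging them shortens d(t).
  · obtain ⟨i, hi'⟩ := exists_descent (w := (d t.1)⁻¹) (by simpa using hd)
    rw [d_inv_lt_iff] at hi'
    have hs : ¬ SameRow t.1 (lo i) (hi i) := by
      intro h
      have : SameRow t.1 (hi i) (lo i) := ⟨h.1.symm, h.2.symm⟩
      exact ((t.2.lt_iff this).1 hi').not_gt (lo_lt_hi i)
    have hs' : ¬ SameRow (t.swap i hs).1 (lo i) (hi i) := by
      intro h
      rw [SameRow, swap_apply, swap_apply, simple_lo, simple_hi] at h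
      exact hs ⟨h.1.symm, h.2.symm⟩
    have hlt : ((t.swap i hs).1 (lo i)).1 < ((t.swap i hs).1 (hi i)).1 := by
      rwa [swap_apply, swap_apply, simple_lo, simple_hi]
    have heq : (t.swap i hs).swap i hs' = t :=
      Subtype.ext (Equiv.ext fun a ↦ by rw [swap_apply, swap_apply, simple_simple])
    rw [← heq]
    refine step _ i hs' hlt (ih _ ?_ _ rfl)
    have := len_simple_mul (i := i) (w := d (t.swap i hs).1) (by rwa [d_inv_lt_iff])
    rw [← d_swap _ _ hs', heq] at this
    omega

theorem mem_youngSubgroup {w : Equiv.Perm (Fin n)} :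
    w ∈ μ.youngSubgroup ↔ ∀ a, SameRow μ.initialTab (w a) a := Iff.rfl

theorem setPartition_part_eq_iff {a b : Fin n} :
    μ.setPartition.part a = μ.setPartition.part b ↔
      comp (μ.initialTab a).1 = comp (μ.initialTab b).1 :=
  part_kerPart_eq_iff (f := fun a ↦ comp (μ.initialTab a).1)

theorem isOfType_setPartition_iff (t : μ.Tab) (α : n.Partition) :
    IsOfType (kerPart fun a ↦ comp (t a).1) α ↔ IsOfType μ.setPartition α := by
  rw [← isOfType_kerPart_comp (fun a ↦ comp (t a).1) (d t)]
  simp only [Function.comp_def, d_apply]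
  rfl

theorem row_lt (hμ : μ.RowsLE N) (x : μ.diagram) : row x.1 < N := by
  by_contra h
  have hm := (μ.mem_diagram _).1 x.2
  rw [hμ _ _ (not_lt.1 h)] at hm
  exact Nat.not_lt_zero _ hm

/-- The word of a row standard multitableau: the row and component numbers of the entries. -/
def RStd.word (hμ : μ.RowsLE N) (t : μ.RStd) (a : Fin n) : Letter N r :=
  (⟨row (t.1 a).1, row_lt hμ _⟩, comp (t.1 a).1)

theorem RStd.word_eq_word_iff (hμ : μ.RowsLE N) (t : μ.RStd) {a b : Fin n} :
    t.word hμ a = t.word hμ b ↔ SameRow t.1 a b := by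
  simp [word, SameRow, Prod.ext_iff, and_comm]

theorem RStd.word_swap (hμ : μ.RowsLE N) (t : μ.RStd) (i : Fin (n - 1))
    (h : ¬ SameRow t.1 (lo i) (hi i)) : (t.swap i h).word hμ = t.word hμ ∘ simple i := rfl

theorem RStd.word_injective (hμ : μ.RowsLE N) : Function.Injective (RStd.word (μ := μ) hμ) := by
  intro t t' h
  refine RStd.ext_of_rows fun a ↦ ?_
  have := congrFun h a
  simp only [word, Prod.ext_iff, Fin.ext_iff] at this
  exact ⟨Fin.ext this.2, this.1⟩

theorem RStd.part_eq_card (hμ : μ.RowsLE N) (t : μ.RStd) (p : Fin r) (i : ℕ) :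
    μ.part p i =
      ({a | (t.word hμ a).2 = p ∧ ((t.word hμ a).1 : ℕ) = i} : Finset (Fin n)).card := by
  rw [← Finset.card_range (μ.part p i)]
  symm
  refine Finset.card_bij (fun a _ ↦ col (t.1 a).1) ?_ ?_ ?_
  · intro a ha
    simp only [Finset.mem_filter, Finset.mem_univ, true_and] at ha
    have := (μ.mem_diagram _).1 (t.1 a).2
    rw [show comp (t.1 a).1 = p from ha.1, show row (t.1 a).1 = i from ha.2] at this
    exact Finset.mem_range.2 this
  · intro a ha b hb h
    simp only [Finset.mem_filter, Finset.mem_univ, true_and] at ha hb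
    exact eq_of_sameRow ⟨ha.1.trans hb.1.symm, ha.2.trans hb.2.symm⟩ h
  · intro c hc
    rw [Finset.mem_range] at hc
    have hm : node p i c ∈ μ.diagram := by rwa [mem_diagram]
    refine ⟨t.1.symm ⟨_, hm⟩, Finset.mem_filter.2 ⟨Finset.mem_univ _, ?_⟩, by simp⟩
    simp only [word, Equiv.apply_symm_apply, comp_node, row_node, and_self]

/-- Row lengths are letter counts, so the word determines the shape; different shapes therefore
involve disjoint sets of basis words. -/
theorem eq_of_word_eq {μ μ' : MultiComp r n} (hμ : μ.RowsLE N) (hμ' : μ'.RowsLE N) {t : μ.RStd}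
    {t' : μ'.RStd} (h : t.word hμ = t'.word hμ') : μ = μ' := by
  ext p i
  rw [t.part_eq_card hμ, t'.part_eq_card hμ', h]

/-! ### The multitableau of a word -/

/-- The multicomposition that counts the letters of a word. -/
def ofWord (w : Fin n → Letter N r) : MultiComp r n where
  part p := Finsupp.onFinset (Finset.range N)
    (fun i ↦ ({a | (w a).2 = p ∧ ((w a).1 : ℕ) = i} : Finset (Fin n)).card) (by
      intro i hi
      obtain ⟨a, ha⟩ := Finset.card_ne_zero.1 hi
      simp only [Finset.mem_filter, Finset.mem_univ, true_and] at ha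
      rw [Finset.mem_range, ← ha.2]
      exact (w a).1.2)
  sum_part := by
    have h1 := Finset.card_eq_sum_card_fiberwise (s := (Finset.univ : Finset (Fin n)))
      (t := (Finset.univ : Finset (Fin r)) ×ˢ Finset.range N)
      (f := fun a ↦ ((w a).2, ((w a).1 : ℕ))) (by intro a _; simp)
    rw [Finset.card_univ, Fintype.card_fin, Finset.sum_product] at h1
    simp only [Prod.mk.injEq] at h1
    conv_rhs => rw [h1]
    refine Finset.sum_congr rfl fun p _ ↦ ?_
    rw [Finsupp.onFinset_sum _ (fun _ ↦ rfl)]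

theorem ofWord_part (w : Fin n → Letter N r) (p : Fin r) (i : ℕ) :
    (ofWord w).part p i = ({a | (w a).2 = p ∧ ((w a).1 : ℕ) = i} : Finset (Fin n)).card := rfl

theorem rowsLE_ofWord (w : Fin n → Letter N r) : (ofWord w).RowsLE N := by
  intro p i hi
  rw [ofWord_part, Finset.card_eq_zero, Finset.filter_eq_empty_iff]
  rintro a - ⟨-, h⟩
  have := (w a).1.2
  omega

/-- The number of earlier occurrences of the letter at a position. -/
def occurrences (w : Fin n → Letter N r) (b : Fin n) : ℕ :=
  ({a | a < b ∧ w a = w b} : Finset (Fin n)).card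

theorem occurrences_lt {w : Fin n → Letter N r} {a b : Fin n} (h : w a = w b) (hab : a < b) :
    occurrences w a < occurrences w b := by
  refine Finset.card_lt_card (Finset.ssubset_iff_of_subset ?_ |>.2 ⟨a, ?_, ?_⟩)
  · intro c hc
    simp only [Finset.mem_filter, Finset.mem_univ, true_and] at hc ⊢
    exact ⟨hc.1.trans hab, hc.2.trans h⟩
  · simpa using ⟨hab, h⟩
  · simp

/-- The row length counts position `a` itself, while `occurrences` counts only earlier positions;
hence the strict inequality. -/
theorem node_mem_ofWord (w : Fin n → Letter N r) (a : Fin n) :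
    node (w a).2 (w a).1 (occurrences w a) ∈ (ofWord w).diagram := by
  rw [mem_diagram, comp_node, row_node, col_node, ofWord_part]
  refine Finset.card_lt_card (Finset.ssubset_iff_of_subset ?_ |>.2 ⟨a, ?_, ?_⟩)
  · intro c hc
    simp only [Finset.mem_filter, Finset.mem_univ, true_and] at hc ⊢
    simp [hc.2]
  · simp
  · simp

/-- The row standard multitableau with a given word. -/
def rstdOfWord (w : Fin n → Letter N r) : (ofWord w).RStd :=
  ⟨Equiv.ofBijective (fun a ↦ ⟨_, node_mem_ofWord w a⟩) (by
    rw [Fintype.bijective_iff_injective_and_card]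
    constructor
    · intro a b h
      have h0 := Subtype.ext_iff.1 h
      have h1 : (w a).2 = (w b).2 := congrArg comp h0
      have h2 : ((w a).1 : ℕ) = (w b).1 := congrArg row h0
      have h3 : occurrences w a = occurrences w b := congrArg col h0
      have h4 : w a = w b := Prod.ext (Fin.ext h2) h1
      rcases lt_trichotomy a b with h | h | h
      · exact absurd h3 (occurrences_lt h4 h).ne
      · exact h
      · exact absurd h3 (occurrences_lt h4.symm h).ne'
    · simp [card_diagram]), by
    intro a b h1 h2 h3
    have h4 : w a = w b := Prod.ext (Fin.ext h2) h1
    by_contra h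
    rcases (not_lt.1 h).eq_or_lt with rfl | h
    · exact lt_irrefl _ h3
    · exact (occurrences_lt h4.symm h).not_gt h3⟩

/-- Together with `word_injective` and `eq_of_word_eq` this is the bijection between words and pairs
of a shape and a row standard multitableau. -/
theorem word_rstdOfWord (w : Fin n → Letter N r) : (rstdOfWord w).word (rowsLE_ofWord w) = w := rfl

end MultiComp
end Tableaux
end BT

namespace BT

/-! ## The elements `x_t` -/

section XTab

variable {R : Type*} [CommRing R] {r n : ℕ} {q : Rˣ} {μ : MultiComp r n}

open MultiComp

/-- An induction principle for the braids and ties algebra. -/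
theorem Alg.induction {P : Alg n q → Prop} (hR : ∀ c : R, P (algebraMap R _ c))
    (hg : ∀ i, P (g q i)) (he : ∀ i, P (e q i)) (hadd : ∀ a b, P a → P b → P (a + b))
    (hmul : ∀ a b, P a → P b → P (a * b)) (a : Alg n q) : P a := by
  obtain ⟨a, rfl⟩ : ∃ b, mk n q b = a := RingQuot.mkAlgHom_surjective R (Rel n q) a
  induction a with
  | grade0 c => simpa using hR c
  | grade1 x =>
    cases x with
    | g i => exact hg i
    | e i => exact he i
  | mul a b ha hb => rw [map_mul]; exact hmul _ _ ha hb
  | add a b ha hb => rw [map_add]; exact hadd _ _ ha hb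

theorem inv_mem_youngSubgroup_comp {w : Equiv.Perm (Fin n)} (hw : w ∈ μ.youngSubgroup)
    (a : Fin n) : SameRow μ.initialTab (w⁻¹ a) a :=
  mem_youngSubgroup.1 (inv_mem hw) a

open Classical in
-- Moving E_{ab} to the left past g_w changes its indices only within their rows, hence within the
-- blocks of A_λ.
theorem idem_mul_gPerm_mul_tie {w : Equiv.Perm (Fin n)} (hw : w ∈ μ.youngSubgroup)
    (a b : Fin n) :
    idem q μ.setPartition * gPerm q w * tie q a b =
      if comp (μ.initialTab a).1 = comp (μ.initialTab b).1 then
        idem q μ.setPartition * gPerm q w else 0 := by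
  rw [mul_assoc, gPerm_mul_tie, ← mul_assoc, idem_mul_tie, ite_mul, zero_mul]
  simp only [setPartition_part_eq_iff, (inv_mem_youngSubgroup_comp hw a).1,
    (inv_mem_youngSubgroup_comp hw b).1]

open Classical in
theorem idem_mul_xElt (q : Rˣ) (μ : MultiComp r n) : idem q μ.setPartition * xElt q μ =
    ∑ w : Equiv.Perm (Fin n) with w ∈ μ.youngSubgroup,
      ((q : R) ^ len w) • (idem q μ.setPartition * gPerm q w) := by
  rw [xElt, Finset.mul_sum]
  simp only [mul_smul_comm]

open Classical in
theorem idem_mul_xElt_mul_tie (a b : Fin n) :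
    idem q μ.setPartition * xElt q μ * tie q a b =
      if comp (μ.initialTab a).1 = comp (μ.initialTab b).1 then
        idem q μ.setPartition * xElt q μ else 0 := by
  rw [idem_mul_xElt, Finset.sum_mul]
  split_ifs with h
  · refine Finset.sum_congr rfl fun w hw ↦ ?_
    rw [smul_mul_assoc, idem_mul_gPerm_mul_tie (Finset.mem_filter.1 hw).2, if_pos h]
  · refine Finset.sum_eq_zero fun w hw ↦ ?_
    rw [smul_mul_assoc, idem_mul_gPerm_mul_tie (Finset.mem_filter.1 hw).2, if_neg h, smul_zero]

theorem simple_mem_youngSubgroup {j : Fin (n - 1)}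
    (hj : SameRow μ.initialTab (lo j) (hi j)) : simple j ∈ μ.youngSubgroup := by
  rw [mem_youngSubgroup]
  intro a
  by_cases h1 : a = lo j
  · rw [h1, simple_lo]; exact ⟨hj.1.symm, hj.2.symm⟩
  by_cases h2 : a = hi j
  · rw [h2, simple_hi]; exact hj
  · rw [simple_of_ne h1 h2]; exact ⟨rfl, rfl⟩

/-- Since j and j + 1 lie in one component, e_j acts as 1 here and g_j satisfies the quadratic
relation of the Hecke algebra. The classical argument then pairs `w` with `simple j * w`. -/
theorem idem_mul_xElt_mul_g {j : Fin (n - 1)} (hj : SameRow μ.initialTab (lo j) (hi j)) :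
    idem q μ.setPartition * xElt q μ * g q j =
      (q : R) • (idem q μ.setPartition * xElt q μ) := by
  classical
  have hs := simple_mem_youngSubgroup hj
  set y : Equiv.Perm (Fin n) → Alg n q := fun w ↦
    ((q : R) ^ len w) • (idem q μ.setPartition * gPerm q w) with hy
  have hsq : ∀ w : Equiv.Perm (Fin n), simple j * (simple j * w) = w := fun w ↦ by
    rw [← mul_assoc, simple_mul_self, one_mul]
  let up (w : Equiv.Perm (Fin n)) : Prop := w⁻¹ (lo j) < w⁻¹ (hi j)
  have hup : ∀ w, up (simple j * w) ↔ ¬ up w := by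
    intro w
    simp only [up, mul_inv_rev, simple_inv, Equiv.Perm.mul_apply, simple_lo, simple_hi, not_lt]
    exact ⟨le_of_lt, fun h ↦ lt_of_le_of_ne h (w⁻¹.injective.ne (lo_ne_hi j).symm)⟩
  have key : ∀ w ∈ μ.youngSubgroup, y w * g q j =
      (if up w then (↑q⁻¹ : R) else (q : R)) • y (simple j * w) +
      (if up w then 0 else (q : R) - (↑q⁻¹ : R)) • y w := by
    intro w hw
    simp only [hy, smul_mul_assoc, mul_assoc]
    by_cases h : up w
    · rw [if_pos h, if_pos h, gPerm_mul_g h, len_simple_mul h, smul_smul, zero_smul, add_zero,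
        pow_succ', ← mul_assoc, Units.inv_mul, one_mul]
    · have h' : w⁻¹ (hi j) < w⁻¹ (lo j) :=
        lt_of_le_of_ne (not_lt.1 h) (w⁻¹.injective.ne (lo_ne_hi j).symm)
      have hl : len w = len (simple j * w) + 1 := by
        conv_lhs => rw [← hsq w]
        exact len_simple_mul ((hup w).2 h)
      have he : idem q μ.setPartition * (gPerm q w * e q j) =
          idem q μ.setPartition * gPerm q w := by
        rw [← tie_lo_hi, ← mul_assoc, idem_mul_gPerm_mul_tie hw, if_pos hj.1]
      rw [if_neg h, if_neg h, gPerm_mul_g_of_gt h', mul_add, mul_smul_comm, he, smul_add, smul_smul,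
        smul_smul, smul_smul, hl, pow_succ']
      ring_nf
  rw [idem_mul_xElt, Finset.sum_mul, Finset.smul_sum]
  rw [Finset.sum_congr rfl fun w hw ↦ key w (Finset.mem_filter.1 hw).2, Finset.sum_add_distrib]
  -- After the substitution the coefficient of `y w` is q + 0 if `up w` holds and q⁻¹ + (q - q⁻¹) if
  -- not, that is, q in both cases.
  have reindex : ∑ w with w ∈ μ.youngSubgroup,
      (if up w then (↑q⁻¹ : R) else (q : R)) • y (simple j * w) =
      ∑ w with w ∈ μ.youngSubgroup, (if up w then (q : R) else (↑q⁻¹ : R)) • y w := by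
    refine Finset.sum_nbij' (fun w ↦ simple j * w) (fun w ↦ simple j * w) ?_ ?_ ?_ ?_ ?_
    · intro w hw
      simp only [Finset.mem_filter, Finset.mem_univ, true_and] at hw ⊢
      exact mul_mem hs hw
    · intro w hw
      simp only [Finset.mem_filter, Finset.mem_univ, true_and] at hw ⊢
      exact mul_mem hs hw
    · intro w _; exact hsq w
    · intro w _; exact hsq w
    · intro w _
      by_cases h : up w
      · rw [if_pos h, if_neg (by rw [hup]; exact not_not.2 h)]
      · rw [if_neg h, if_pos ((hup w).2 h)]
  rw [reindex, ← Finset.sum_add_distrib]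
  refine Finset.sum_congr rfl fun w _ ↦ ?_
  rw [← add_smul]
  split_ifs <;> simp [hy]

/-! ### The action of the generators on the x_t. -/

open Classical in
theorem xTab_mul_tie (t : μ.RStd) (a b : Fin n) :
    xTab q t * tie q a b = if comp (t.1 a).1 = comp (t.1 b).1 then xTab q t else 0 := by
  rw [xTab, mul_assoc, gPerm_mul_tie, ← mul_assoc, idem_mul_xElt_mul_tie, initialTab_d_inv,
    initialTab_d_inv, ite_mul, zero_mul]

open Classical in
theorem xTab_mul_e (t : μ.RStd) (i : Fin (n - 1)) :
    xTab q t * e q i = if comp (t.1 (lo i)).1 = comp (t.1 (hi i)).1 then xTab q t else 0 := by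
  rw [← tie_lo_hi, xTab_mul_tie]

theorem xTab_mul_g_of_lt (t : μ.RStd) {i : Fin (n - 1)} (h : ¬ SameRow t.1 (lo i) (hi i))
    (hlt : (t.1 (lo i)).1 < (t.1 (hi i)).1) : xTab q t * g q i = xTab q (t.swap i h) := by
  rw [xTab, xTab, mul_assoc, gPerm_mul_g (by rwa [d_inv_lt_iff]), RStd.d_swap]

open Classical in
theorem xTab_mul_g_of_gt (t : μ.RStd) {i : Fin (n - 1)} (h : ¬ SameRow t.1 (lo i) (hi i))
    (hlt : (t.1 (hi i)).1 < (t.1 (lo i)).1) :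
    xTab q t * g q i = xTab q (t.swap i h) +
      (if comp (t.1 (lo i)).1 = comp (t.1 (hi i)).1 then (q : R) - (↑q⁻¹ : R) else 0) •
        xTab q t := by
  have h1 : xTab q t * g q i = xTab q (t.swap i h) +
      ((q : R) - (↑q⁻¹ : R)) • (xTab q t * e q i) := by
    rw [xTab, xTab, mul_assoc, gPerm_mul_g_of_gt (by rwa [d_inv_lt_iff]), RStd.d_swap, mul_add,
      mul_smul_comm]
    simp only [mul_assoc]
  rw [h1, xTab_mul_e]
  split_ifs <;> simp

/-- If i and i + 1 lie in one row, their nodes are neighbours: a node strictly between them would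
belong to the same row, and its entry would lie strictly between i and i + 1. -/
theorem exists_simple_of_sameRow (t : μ.RStd) {i : Fin (n - 1)}
    (h : SameRow t.1 (lo i) (hi i)) :
    ∃ j, d t.1 (lo j) = lo i ∧ d t.1 (hi j) = hi i ∧ SameRow μ.initialTab (lo j) (hi j) := by
  have hlt : (d t.1)⁻¹ (lo i) < (d t.1)⁻¹ (hi i) := by
    rw [d_inv_lt_iff, t.2.lt_iff h]; exact lo_lt_hi i
  obtain ⟨j, hj⟩ := exists_lo_eq hlt
  have hle : hi j ≤ (d t.1)⁻¹ (hi i) := by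
    rw [← hj] at hlt
    exact hlt
  have e1 : d t.1 (lo j) = lo i := by rw [hj]; exact (d t.1).apply_symm_apply _
  have hji : μ.initialTab (lo j) = t.1 (lo i) := by rw [hj, initialTab_d_inv]
  have hkey : hi j = (d t.1)⁻¹ (hi i) := by
    refine hle.eq_or_lt.resolve_right fun hlt' ↦ ?_
    have h1 : (μ.initialTab (lo j)).1 < (μ.initialTab (hi j)).1 :=
      initialTab_lt_iff.2 (lo_lt_hi j)
    have h2 : (μ.initialTab (hi j)).1 < (t.1 (hi i)).1 := by
      rw [← initialTab_d_inv t.1]; exact initialTab_lt_iff.2 hlt'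
    have h3 : (t.1 (d t.1 (hi j))).1 = (μ.initialTab (hi j)).1 := by rw [d_apply]
    rw [hji] at h1
    have hrow : SameRow t.1 (lo i) (d t.1 (hi j)) := by
      rw [node_lt_iff] at h1 h2
      rw [SameRow, h3]
      obtain ⟨ha, hb⟩ := h
      rw [← ha, ← hb] at h2
      constructor
      · rcases h1 with h1 | h1
        · rcases h2 with h2 | h2
          · exact absurd h2 h1.not_gt
          · exact absurd h2.1 h1.ne'
        · exact h1.1
      · rcases h1 with h1 | h1
        · rcases h2 with h2 | h2
          · exact absurd h2 h1.not_gt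
          · exact absurd h2.1 h1.ne'
        · rcases h2 with h2 | h2
          · exact absurd h1.1 h2.ne'
          · omega
    have hrow' : SameRow t.1 (d t.1 (hi j)) (hi i) :=
      ⟨hrow.1.symm.trans h.1, hrow.2.symm.trans h.2⟩
    rw [← h3] at h1 h2
    have h4 := (t.2.lt_iff hrow).1 h1
    have h5 := (t.2.lt_iff hrow').1 h2
    rw [Fin.lt_def] at h4 h5
    simp only [lo_val, hi_val] at h4 h5
    omega
  refine ⟨j, e1, ?_, ?_⟩
  · rw [hkey]; exact (d t.1).apply_symm_apply _
  · rw [SameRow, hji, hkey, initialTab_d_inv]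
    exact h

/-- Both g_{d(t)} g_i and g_j g_{d(t)} are length-additive products for the same permutation, so g_i
moves across g_{d(t)} and becomes a g_j from the row stabilizer. -/
theorem xTab_mul_g_of_sameRow (t : μ.RStd) {i : Fin (n - 1)}
    (h : SameRow t.1 (lo i) (hi i)) : xTab q t * g q i = (q : R) • xTab q t := by
  obtain ⟨j, h1, h2, hj⟩ := exists_simple_of_sameRow t h
  have hlt : (d t.1)⁻¹ (lo i) < (d t.1)⁻¹ (hi i) := by
    rw [d_inv_lt_iff, t.2.lt_iff h]; exact lo_lt_hi i
  have hcomm : simple i * d t.1 = d t.1 * simple j := by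
    rw [simple, simple, ← h1, ← h2, Equiv.mul_swap_eq_swap_mul]
  rw [xTab, mul_assoc, gPerm_mul_g hlt, hcomm, ← g_mul_gPerm (by rw [h1, h2]; exact lo_lt_hi i),
    ← mul_assoc, idem_mul_xElt_mul_g hj, smul_mul_assoc]

/-! ### The x_t span M(λ). -/

theorem xTab_initialRStd : xTab q μ.initialRStd = idem q μ.setPartition * xElt q μ := by
  rw [xTab, show μ.initialRStd.1 = μ.initialTab from rfl, d_initialTab, gPerm_one, mul_one]

/-- The element x_t is a joint eigenvector of the E_{ab}, with set partition given by the components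
of t. -/
theorem xTab_mul_idemType {α : n.Partition} (hα : IsOfType μ.setPartition α) (t : μ.RStd) :
    xTab q t * idemType q α = xTab q t := by
  classical
  have hz : ∀ a b, op (tie q a b) • xTab q t =
      if (kerPart fun a ↦ comp (t.1 a).1).part a = (kerPart fun a ↦ comp (t.1 a).1).part b
        then xTab q t else 0 := by
    intro a b
    simp only [part_kerPart_eq_iff, op_smul_eq_mul, xTab_mul_tie]
  rw [← op_smul_eq_mul, op_idemType_smul hz, if_pos]
  rwa [isOfType_setPartition_iff]

/-- As 𝔼_α fixes the generator, the factor 𝔼_α in the definition of M(λ) can be dropped, and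
centrality of 𝔼_α is not needed. -/
theorem mem_permModule_iff {α : n.Partition} (hα : IsOfType μ.setPartition α) {x : Alg n q} :
    x ∈ permModule q α μ ↔ ∃ a, xTab q μ.initialRStd * a = x := by
  have h := xTab_mul_idemType (q := q) hα μ.initialRStd
  simp only [permModule, ideal, Submodule.mem_map, LinearMap.mem_range]
  constructor
  · rintro ⟨_, ⟨a, rfl⟩, rfl⟩
    refine ⟨idemType q α * a, ?_⟩
    rw [xTab_initialRStd]; rfl
  · rintro ⟨a, rfl⟩
    refine ⟨_, ⟨a, rfl⟩, ?_⟩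
    change idem q μ.setPartition * xElt q μ * (idemType q α * a) = _
    rw [← mul_assoc, ← xTab_initialRStd, h]

theorem xTab_mem_permModule {α : n.Partition} (hα : IsOfType μ.setPartition α) (t : μ.RStd) :
    xTab q t ∈ permModule q α μ := by
  rw [mem_permModule_iff hα]
  exact ⟨gPerm q (d t.1), by rw [xTab_initialRStd, xTab]⟩

theorem xTab_mul_g_mem_span (t : μ.RStd) (i : Fin (n - 1)) :
    xTab q t * g q i ∈ Submodule.span R (Set.range fun t : μ.RStd ↦ xTab q t) := by
  classical
  have hm : ∀ t : μ.RStd, xTab q t ∈ Submodule.span R (Set.range fun t : μ.RStd ↦ xTab q t) :=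
    fun t ↦ Submodule.subset_span ⟨t, rfl⟩
  by_cases h : SameRow t.1 (lo i) (hi i)
  · rw [xTab_mul_g_of_sameRow t h]
    exact Submodule.smul_mem _ _ (hm t)
  · rcases lt_or_gt_of_ne (fun h' ↦ lo_ne_hi i (t.1.injective (Subtype.ext h')) :
      (t.1 (lo i)).1 ≠ (t.1 (hi i)).1) with hlt | hlt
    · rw [xTab_mul_g_of_lt t h hlt]
      exact hm _
    · rw [xTab_mul_g_of_gt t h hlt]
      exact add_mem (hm _) (Submodule.smul_mem _ _ (hm t))

theorem mul_mem_span_xTab {x : Alg n q}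
    (hx : x ∈ Submodule.span R (Set.range fun t : μ.RStd ↦ xTab q t)) (a : Alg n q) :
    x * a ∈ Submodule.span R (Set.range fun t : μ.RStd ↦ xTab q t) := by
  classical
  have gen : ∀ a : Alg n q, (∀ t : μ.RStd, xTab q t * a ∈
      Submodule.span R (Set.range fun t : μ.RStd ↦ xTab q t)) →
      ∀ x ∈ Submodule.span R (Set.range fun t : μ.RStd ↦ xTab q t), x * a ∈
        Submodule.span R (Set.range fun t : μ.RStd ↦ xTab q t) := by
    intro a ha x hx
    induction hx using Submodule.span_induction with
    | mem x hx => obtain ⟨t, rfl⟩ := hx; exact ha t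
    | zero => simp
    | add x y _ _ hx hy => rw [add_mul]; exact add_mem hx hy
    | smul c x _ hx => rw [smul_mul_assoc]; exact Submodule.smul_mem _ _ hx
  induction a using Alg.induction generalizing x with
  | hR c => rw [← Algebra.commutes, ← Algebra.smul_def]; exact Submodule.smul_mem _ _ hx
  | hg i => exact gen _ (fun t ↦ xTab_mul_g_mem_span t i) x hx
  | he i =>
    refine gen _ (fun t ↦ ?_) x hx
    rw [xTab_mul_e]
    split_ifs
    · exact Submodule.subset_span ⟨t, rfl⟩
    · exact zero_mem _
  | hadd a b ha hb => rw [mul_add]; exact add_mem (ha hx) (hb hx)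
  | hmul a b ha hb => rw [← mul_assoc]; exact hb (ha hx)

theorem mem_span_xTab_of_mem_permModule {α : n.Partition} (hα : IsOfType μ.setPartition α)
    {x : Alg n q} (hx : x ∈ permModule q α μ) :
    x ∈ Submodule.span R (Set.range fun t : μ.RStd ↦ xTab q t) := by
  obtain ⟨a, rfl⟩ := (mem_permModule_iff hα).1 hx
  exact mul_mem_span_xTab (Submodule.subset_span ⟨_, rfl⟩) a

end XTab
end BT

namespace BT

/-! ## The action on words -/

section Words

variable {R : Type*} [CommRing R] {n N r : ℕ} {q : Rˣ}

open MultiComp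

instance : IsScalarTower R (Alg n q)ᵐᵒᵖ (TensorSpace R n N r) where
  smul_assoc c a v := by
    change (tensorAction q n N r (unop (c • a))).unop v = c • (tensorAction q n N r (unop a)).unop v
    rw [MulOpposite.unop_smul, map_smul]; rfl

theorem op_g_smul (i : Fin (n - 1)) (v : TensorSpace R n N r) :
    op (g q i) • v = opG q (lo i) (hi i) v := by
  rw [op_smul_tensor, tensorAction_g]; rfl

theorem op_e_smul (i : Fin (n - 1)) (v : TensorSpace R n N r) :
    op (e q i) • v = opE (lo i) (hi i) v := by
  rw [op_smul_tensor, tensorAction_e]; rfl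

theorem op_g_smul_word (i : Fin (n - 1)) (w : Fin n → Letter N r) :
    op (g q i) • wordBasis R n N r w = cG q (w (lo i)) (w (hi i)) • wordBasis R n N r w
      + dG R (w (lo i)) (w (hi i)) • wordBasis R n N r (w ∘ simple i) := by
  rw [op_g_smul, opG_basis]; rfl

/-- The diagonal part of 𝐆 is nonzero only if the letters at a and b have the same component, and
then comparing c with a or with b is the same test. -/
theorem opE_opG_of_ne {a b c : Fin n} (hca : c ≠ a) (hcb : c ≠ b) :
    (opE b c * opG q a b : Module.End R (TensorSpace R n N r)) = opG q a b * opE a c := by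
  refine (wordBasis R n N r).ext fun w ↦ ?_
  simp only [Module.End.mul_apply, opG_basis, opE_basis, map_add, map_smul, comp_swap_right,
    comp_swap_of_ne hca hcb]
  have h1 := cG_mul_cE q (w a) (w b)
  have h2 := cE_trans R (w a) (w b) (w c)
  have h3 : cG q (w a) (w b) * cE R (w b) (w c) = cE R (w a) (w c) * cG q (w a) (w b) := by
    rw [← h1, mul_assoc, h2, mul_comm (cE R (w a) (w c)), mul_assoc]
  match_scalars
  · linear_combination h3
  · ring

/-- Follows the recursion for E_{ij}; `opE_opG_of_ne` moves the operator past 𝐆, which then cancels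
against the action of g_i⁻¹. -/
theorem op_EAux_smul (k i : ℕ) (h : i + k + 1 < n) (v : TensorSpace R n N r) :
    op (EAux q k i h) • v = opE (⟨i, by omega⟩ : Fin n) ⟨i + k + 1, h⟩ v := by
  induction k generalizing i v with
  | zero => rw [EAux, op_e_smul]; rfl
  | succ k ih =>
    set j : Fin (n - 1) := ⟨i, by omega⟩ with hj
    have hc : ∀ x : Fin n, x = ⟨i + 1 + k + 1, by omega⟩ → x ≠ lo j ∧ x ≠ hi j := by
      rintro x rfl
      simp only [ne_eq, Fin.ext_iff, lo_val, hi_val, hj]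
      omega
    have hx : (⟨i + (k + 1) + 1, h⟩ : Fin n) = ⟨i + 1 + k + 1, by omega⟩ :=
      Fin.ext (by simp only; omega)
    obtain ⟨h1, h2⟩ := hc _ rfl
    have h3 := LinearMap.congr_fun (opE_opG_of_ne (q := q) (N := N) (r := r) (R := R) h1 h2) v
    rw [Module.End.mul_apply, Module.End.mul_apply, ← op_g_smul, ← op_g_smul] at h3
    rw [EAux, MulOpposite.op_mul, mul_smul, MulOpposite.op_mul, mul_smul, ih, hx]
    change op (gUnit q j)⁻¹.val • opE (hi j) _ (op (g q j) • v) = opE (lo j) _ v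
    rw [h3, ← mul_smul, ← MulOpposite.op_mul, show g q j = (gUnit q j).val from rfl,
      Units.mul_inv, MulOpposite.op_one, one_smul]

theorem op_tie_smul (a b : Fin n) (v : TensorSpace R n N r) : op (tie q a b) • v = opE a b v := by
  have key : ∀ {a b : Fin n}, a < b → op (tie q a b) • v = opE a b v := by
    intro a b h
    rw [tie_of_lt h, EPair, op_EAux_smul]
    congr 2
    rw [Fin.lt_def] at h
    exact Fin.ext (by simp only; omega)
  have hsymm : ∀ a b : Fin n, (opE a b : Module.End R (TensorSpace R n N r)) = opE b a := by
    intro a b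
    refine (wordBasis R n N r).ext fun w ↦ ?_
    rw [opE_basis, opE_basis, cE_comm]
  rcases lt_trichotomy a b with h | rfl | h
  · exact key h
  · have : (opE a a : Module.End R (TensorSpace R n N r)) = 1 := by
      refine (wordBasis R n N r).ext fun w ↦ ?_
      simp [opE_basis, cE]
    simp [this]
  · rw [tie_comm, key h, hsymm]

open Classical in
theorem op_tie_smul_word (a b : Fin n) (w : Fin n → Letter N r) :
    op (tie q a b) • wordBasis R n N r w =
      if (kerPart fun a ↦ (w a).2).part a = (kerPart fun a ↦ (w a).2).part b
        then wordBasis R n N r w else 0 := by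
  simp only [op_tie_smul, opE_basis, part_kerPart_eq_iff, cE, ite_smul, one_smul, zero_smul]

open Classical in
theorem op_idemType_smul_word (α : n.Partition) (w : Fin n → Letter N r) :
    op (idemType q α) • wordBasis R n N r w =
      if IsOfType (kerPart fun a ↦ (w a).2) α then wordBasis R n N r w else 0 :=
  op_idemType_smul (fun a b ↦ op_tie_smul_word a b w) α

/-! ### The action of the generators on the v_t. -/

variable {μ : MultiComp r n}

theorem vTab_eq (hμ : μ.RowsLE N) (t : μ.RStd) :
    vTab R hμ t = wordBasis R n N r (t.word hμ) := by
  refine Eq.trans ?_ (Basis.piTensorProduct_apply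
    (fun _ : Fin n ↦ (Finsupp.basisSingleOne : Module.Basis (Letter N r) R _)) (t.word hμ)).symm
  rw [vTab]
  simp only [Finsupp.coe_basisSingleOne]
  rfl

theorem op_e_smul_vTab (hμ : μ.RowsLE N) (t : μ.RStd) (i : Fin (n - 1)) [Decidable
    (comp (t.1 (lo i)).1 = comp (t.1 (hi i)).1)] : op (e q i) • vTab R hμ t =
      if comp (t.1 (lo i)).1 = comp (t.1 (hi i)).1 then vTab R hμ t else 0 := by
  rw [vTab_eq, op_e_smul, opE_basis, cE]
  by_cases h : comp (t.1 (lo i)).1 = comp (t.1 (hi i)).1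
  · rw [if_pos h, if_pos (show (t.word hμ _).2 = (t.word hμ _).2 from h), one_smul]
  · rw [if_neg h, if_neg (show (t.word hμ _).2 ≠ (t.word hμ _).2 from h), zero_smul]

theorem op_g_smul_vTab_of_sameRow (hμ : μ.RowsLE N) (t : μ.RStd) {i : Fin (n - 1)}
    (h : SameRow t.1 (lo i) (hi i)) : op (g q i) • vTab R hμ t = (q : R) • vTab R hμ t := by
  have h' := (RStd.word_eq_word_iff hμ t).2 h
  rw [vTab_eq, op_g_smul_word, h', cG, dG]
  simp

theorem op_g_smul_vTab_of_lt (hμ : μ.RowsLE N) (t : μ.RStd) {i : Fin (n - 1)}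
    (h : ¬ SameRow t.1 (lo i) (hi i)) (hlt : (t.1 (lo i)).1 < (t.1 (hi i)).1) :
    op (g q i) • vTab R hμ t = vTab R hμ (t.swap i h) := by
  have h' := mt (RStd.word_eq_word_iff hμ t).1 h
  have hc : cG q (t.word hμ (lo i)) (t.word hμ (hi i)) = 0 := by
    rw [node_lt_iff] at hlt
    simp only [cG, RStd.word, Fin.ext_iff, Fin.lt_def]
    by_cases hcomp : comp (t.1 (lo i)).1 = comp (t.1 (hi i)).1
    · have hr : row (t.1 (lo i)).1 < row (t.1 (hi i)).1 := by
        rcases hlt with hlt | ⟨-, hlt | hlt⟩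
        · exact absurd hcomp hlt.ne
        · exact hlt
        · exact absurd ⟨hcomp, hlt.1⟩ h
      simp [hcomp, hr, hr.ne]
    · rw [if_pos]
      exact hcomp
  rw [vTab_eq, vTab_eq, op_g_smul_word, RStd.word_swap, hc, dG, if_neg h', zero_smul, zero_add,
    one_smul]

open Classical in
theorem op_g_smul_vTab_of_gt (hμ : μ.RowsLE N) (t : μ.RStd) {i : Fin (n - 1)}
    (h : ¬ SameRow t.1 (lo i) (hi i)) (hlt : (t.1 (hi i)).1 < (t.1 (lo i)).1) :
    op (g q i) • vTab R hμ t = vTab R hμ (t.swap i h) +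
      (if comp (t.1 (lo i)).1 = comp (t.1 (hi i)).1 then (q : R) - (↑q⁻¹ : R) else 0) •
        vTab R hμ t := by
  have h' := mt (RStd.word_eq_word_iff hμ t).1 h
  have hc : cG q (t.word hμ (lo i)) (t.word hμ (hi i)) =
      if comp (t.1 (lo i)).1 = comp (t.1 (hi i)).1 then (q : R) - (↑q⁻¹ : R) else 0 := by
    rw [node_lt_iff] at hlt
    simp only [cG, RStd.word, Fin.mk.injEq, Fin.mk_lt_mk]
    by_cases hcomp : comp (t.1 (lo i)).1 = comp (t.1 (hi i)).1
    · have hr : row (t.1 (hi i)).1 < row (t.1 (lo i)).1 := by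
        rcases hlt with hlt | ⟨-, hlt | hlt⟩
        · exact absurd hcomp hlt.ne'
        · exact hlt
        · exact absurd ⟨hcomp, hlt.1.symm⟩ h
      simp [hcomp, hr.not_gt, hr.ne']
    · simp [hcomp]
  rw [vTab_eq, vTab_eq, op_g_smul_word, RStd.word_swap, hc, dG, if_neg h', one_smul, add_comm]

/-! ## Linear independence -/

theorem perm_induction {P : Equiv.Perm (Fin n) → Prop} (one : P 1)
    (step : ∀ w i, w⁻¹ (lo i) < w⁻¹ (hi i) → P w → P (simple i * w)) (w : Equiv.Perm (Fin n)) :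
    P w := by
  induction hk : len w using Nat.strong_induction_on generalizing w with
  | _ k ih =>
  by_cases hw : w = 1
  · rwa [hw]
  · obtain ⟨i, hi'⟩ := exists_descent (w := w⁻¹) (by simpa using hw)
    have h1 : simple i * (simple i * w) = w := by rw [← mul_assoc, simple_mul_self, one_mul]
    have h2 : (simple i * w)⁻¹ (lo i) < (simple i * w)⁻¹ (hi i) := by simpa using hi'
    have h3 := len_simple_mul h2
    rw [h1] at h3
    rw [← h1]
    exact step _ i h2 (ih _ (by omega) _ rfl)

variable (μ) in
/-- The word with the pairwise distinct letters `(a, s)`, where `s` is the component of `a` in the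
initial multitableau, permuted by `y`. -/
def distinctWord (y : Equiv.Perm (Fin n)) (a : Fin n) : Letter n r :=
  (y⁻¹ a, comp (μ.initialTab (y⁻¹ a)).1)

/-- The row numbers of the letters are pairwise distinct and here in increasing order, so the
diagonal term of 𝐆 vanishes whether or not the components agree. -/
theorem op_g_smul_distinctWord {y : Equiv.Perm (Fin n)} {i : Fin (n - 1)}
    (h : y⁻¹ (lo i) < y⁻¹ (hi i)) :
    op (g q i) • wordBasis R n n r (distinctWord μ y) =
      wordBasis R n n r (distinctWord μ (simple i * y)) := by
  have hd : dG R ((distinctWord μ y) (lo i)) ((distinctWord μ y) (hi i)) = 1 := by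
    rw [dG, if_neg]
    exact fun h' ↦ h.ne (congrArg Prod.fst h')
  have hc : cG q ((distinctWord μ y) (lo i)) ((distinctWord μ y) (hi i)) = 0 := by
    rw [cG]
    split_ifs with h1 h2 h3
    · rfl
    · exact absurd h2 h.ne
    · rfl
    · exact absurd h h3
  rw [op_g_smul_word, hc, hd, zero_smul, zero_add, one_smul]
  rfl

theorem op_gPerm_smul_distinctWord (w : Equiv.Perm (Fin n)) :
    op (gPerm q w) • wordBasis R n n r (distinctWord μ 1) =
      wordBasis R n n r (distinctWord μ w) := by
  induction w using perm_induction with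
  | one => rw [gPerm_one, MulOpposite.op_one, one_smul]
  | step w i h ih =>
    rw [← gPerm_mul_g h, MulOpposite.op_mul, mul_smul, ih, op_g_smul_distinctWord h]

open Classical in
theorem op_xTab_smul_distinctWord (t : μ.RStd) :
    op (xTab q t) • wordBasis R n n r (distinctWord μ 1) =
      ∑ w : Equiv.Perm (Fin n) with w ∈ μ.youngSubgroup,
        ((q : R) ^ len w) • wordBasis R n n r (distinctWord μ (d t.1 * w)) := by
  induction t using RStd.induction with
  | init =>
    rw [xTab_initialRStd, show μ.initialRStd.1 = μ.initialTab from rfl, d_initialTab,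
      idem_mul_xElt, Finset.op_sum, Finset.sum_smul]
    refine Finset.sum_congr rfl fun w _ ↦ ?_
    have h1 : op (idem q μ.setPartition) • wordBasis R n n r (distinctWord μ 1) =
        wordBasis R n n r (distinctWord μ 1) := by
      rw [op_idem_smul (fun a b ↦ op_tie_smul_word a b (distinctWord μ 1)), if_pos]
      rfl
    rw [MulOpposite.op_smul, smul_assoc, MulOpposite.op_mul, mul_smul, h1,
      op_gPerm_smul_distinctWord, one_mul]
  | step t i h hlt ih =>
    rw [← xTab_mul_g_of_lt t h hlt, MulOpposite.op_mul, mul_smul, ih, Finset.smul_sum]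
    refine Finset.sum_congr rfl fun w hw ↦ ?_
    rw [smul_comm, op_g_smul_distinctWord, RStd.d_swap, mul_assoc]
    -- Elements of the row stabilizer preserve rows, and i and i + 1 lie in different rows of t; so
    -- the ascent of d(t) at i is also one for every element of its coset.
    have hw' := inv_mem_youngSubgroup_comp (Finset.mem_filter.1 hw).2
    rw [mul_inv_rev, Equiv.Perm.mul_apply, Equiv.Perm.mul_apply, ← initialTab_lt_iff (μ := μ),
      node_lt_iff, (hw' _).1, (hw' _).1, (hw' _).2, (hw' _).2, initialTab_d_inv, initialTab_d_inv]
    rw [node_lt_iff] at hlt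
    rcases hlt with hlt | ⟨hlt, hlt' | hlt'⟩
    · exact .inl hlt
    · exact .inr ⟨hlt, .inl hlt'⟩
    · exact absurd ⟨hlt, hlt'.1⟩ h

/-- Multitableaux in one coset of the row stabilizer have the same row contents, and these determine
a row standard one. -/
theorem eq_of_d_mul_eq {t t' : μ.RStd} {w : Equiv.Perm (Fin n)} (hw : w ∈ μ.youngSubgroup)
    (h : d t.1 * w = d t'.1) : t = t' := by
  refine RStd.ext_of_rows fun a ↦ ?_
  have h1 : (d t'.1)⁻¹ a = w⁻¹ ((d t.1)⁻¹ a) := by rw [← h, mul_inv_rev]; rfl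
  have h2 := inv_mem_youngSubgroup_comp hw ((d t.1)⁻¹ a)
  rw [← h1, SameRow, initialTab_d_inv, initialTab_d_inv] at h2
  exact ⟨h2.1.symm, h2.2.symm⟩

theorem linearIndependent_xTab (q : Rˣ) (μ : MultiComp r n) :
    LinearIndependent R fun t : μ.RStd ↦ xTab q t := by
  classical
  let F : Alg n q →ₗ[R] TensorSpace R n n r :=
    { toFun := fun a ↦ op a • wordBasis R n n r (distinctWord μ 1)
      map_add' := fun a b ↦ by rw [MulOpposite.op_add, add_smul]
      map_smul' := fun c a ↦ by rw [MulOpposite.op_smul, smul_assoc]; rfl }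
  -- The words indexed by the d(t') give a family of coordinates dual to the x_t: only w = 1
  -- contributes, with coefficient q⁰ = 1.
  have hF : ∀ t t' : μ.RStd, (wordBasis R n n r).repr (F (xTab q t))
      (distinctWord μ (d t'.1)) = if t = t' then 1 else 0 := by
    intro t t'
    change (wordBasis R n n r).repr (op (xTab q t) • wordBasis R n n r (distinctWord μ 1)) _ = _
    rw [op_xTab_smul_distinctWord, map_sum, Finsupp.finsetSum_apply]
    have hterm : ∀ w ∈ ({w | w ∈ μ.youngSubgroup} : Finset (Equiv.Perm (Fin n))),
        (wordBasis R n n r).repr (((q : R) ^ len w) •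
          wordBasis R n n r (distinctWord μ (d t.1 * w))) (distinctWord μ (d t'.1)) =
        if w = 1 then (if t = t' then 1 else 0) else 0 := by
      intro w hw
      rw [map_smul, Finsupp.smul_apply, Module.Basis.repr_self, Finsupp.single_apply]
      have hiff : distinctWord μ (d t.1 * w) = distinctWord μ (d t'.1) ↔
          d t.1 * w = d t'.1 := by
        refine ⟨fun h ↦ inv_injective (Equiv.ext fun a ↦ ?_), fun h ↦ by rw [h]⟩
        exact congrArg Prod.fst (congrFun h a)
      simp only [hiff]
      by_cases h : d t.1 * w = d t'.1
      · obtain rfl := eq_of_d_mul_eq (Finset.mem_filter.1 hw).2 h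
        have hw1 : w = 1 := by simpa using h
        simp [hw1]
      · rw [if_neg h, smul_zero]
        split_ifs with h1 h2
        · subst h1 h2; simp at h
        · rfl
        · rfl
    rw [Finset.sum_congr rfl hterm, Finset.sum_ite_eq', if_pos]
    simp [one_mem]
  rw [linearIndependent_iff']
  intro s c hc t ht
  have h1 := congrArg (fun x ↦ (wordBasis R n n r).repr (F x) (distinctWord μ (d t.1))) hc
  simp only [map_sum, map_smul, Finsupp.finsetSum_apply, Finsupp.smul_apply, hF, map_zero,
    Finsupp.coe_zero, Pi.zero_apply, smul_eq_mul, mul_ite, mul_one, mul_zero] at h1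
  rwa [Finset.sum_ite_eq', if_pos ht] at h1

end Words
end BT

namespace BT

/-! ## The embeddings of the permutation modules -/

theorem basis_induction {ι R M : Type*} [Semiring R] [AddCommMonoid M] [Module R M]
    (b : Module.Basis ι R M) {P : M → Prop} (coe : ∀ i, P (b i)) (zero : P 0)
    (add : ∀ x y, P x → P y → P (x + y)) (smul : ∀ (c : R) x, P x → P (c • x)) (x : M) : P x := by
  have hx : x ∈ Submodule.span R (Set.range b) := b.span_eq ▸ Submodule.mem_top
  induction hx using Submodule.span_induction with
  | mem x hx => obtain ⟨i, rfl⟩ := hx; exact coe i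
  | zero => exact zero
  | add x y _ _ hx hy => exact add x y hx hy
  | smul c x _ hx => exact smul c x hx

section Embedding

variable {R : Type*} [CommRing R] {n N r : ℕ} {q : Rˣ} {α : n.Partition}

open MultiComp

variable (q) in
/-- The basis of the permutation module that consists of the `x_t`. -/
def xBasis {μ : MultiComp r n} (hα : IsOfType μ.setPartition α) :
    Module.Basis μ.RStd R (permModule q α μ) :=
  Module.Basis.mk (v := fun t ↦ ⟨xTab q t, xTab_mem_permModule hα t⟩)
    (LinearIndependent.of_comp ((permModule q α μ).subtype.restrictScalars R)
      (linearIndependent_xTab q μ)) (by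
    rintro ⟨x, hx⟩ -
    have h := mem_span_xTab_of_mem_permModule hα hx
    have hr : (Set.range fun t : μ.RStd ↦ xTab q t) =
        ((permModule q α μ).subtype.restrictScalars R) '' Set.range
          (fun t : μ.RStd ↦ (⟨xTab q t, xTab_mem_permModule hα t⟩ : permModule q α μ)) := by
      rw [← Set.range_comp]; rfl
    rw [hr, ← Submodule.map_span] at h
    obtain ⟨y, hy, hyx⟩ := h
    rwa [show (⟨x, hx⟩ : permModule q α μ) = y from Subtype.ext hyx.symm])

theorem xBasis_apply {μ : MultiComp r n} (hα : IsOfType μ.setPartition α) (t : μ.RStd) :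
    xBasis q hα t = ⟨xTab q t, xTab_mem_permModule hα t⟩ := by
  rw [xBasis, Module.Basis.mk_apply]

theorem smul_xBasis {μ : MultiComp r n} (hα : IsOfType μ.setPartition α) (t : μ.RStd)
    (a : Alg n q) : ((op a • xBasis q hα t : permModule q α μ) : Alg n q) = xTab q t * a := by
  rw [xBasis_apply]; rfl

variable (q) in
/-- The `R`-linear map with `x_t ↦ v_t`. -/
def embeddingLinear {μ : MultiComp r n} (hμ : μ.RowsLE N) (hα : IsOfType μ.setPartition α) :
    permModule q α μ →ₗ[R] TensorSpace R n N r :=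
  (xBasis q hα).constr R fun t ↦ vTab R hμ t

theorem embeddingLinear_xBasis {μ : MultiComp r n} (hμ : μ.RowsLE N)
    (hα : IsOfType μ.setPartition α) (t : μ.RStd) :
    embeddingLinear q hμ hα (xBasis q hα t) = vTab R hμ t :=
  Module.Basis.constr_basis ..

theorem embeddingLinear_smul_xBasis_g {μ : MultiComp r n} (hμ : μ.RowsLE N)
    (hα : IsOfType μ.setPartition α) (i : Fin (n - 1)) (t : μ.RStd) :
    embeddingLinear q hμ hα (op (g q i) • xBasis q hα t) = op (g q i) • vTab R hμ t := by
  classical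
  by_cases h : SameRow t.1 (lo i) (hi i)
  · have h1 : op (g q i) • xBasis q hα t = (q : R) • xBasis q hα t := by
      apply Subtype.ext
      rw [smul_xBasis, xTab_mul_g_of_sameRow t h, xBasis_apply]
      rfl
    rw [h1, map_smul, embeddingLinear_xBasis, op_g_smul_vTab_of_sameRow hμ t h]
  · rcases lt_or_gt_of_ne (fun h' ↦ lo_ne_hi i (t.1.injective (Subtype.ext h')) :
      (t.1 (lo i)).1 ≠ (t.1 (hi i)).1) with hlt | hlt
    · have h1 : op (g q i) • xBasis q hα t = xBasis q hα (t.swap i h) := by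
        apply Subtype.ext
        rw [smul_xBasis, xTab_mul_g_of_lt t h hlt, xBasis_apply]
      rw [h1, embeddingLinear_xBasis, op_g_smul_vTab_of_lt hμ t h hlt]
    · have h1 : op (g q i) • xBasis q hα t = xBasis q hα (t.swap i h) +
          (if comp (t.1 (lo i)).1 = comp (t.1 (hi i)).1 then (q : R) - (↑q⁻¹ : R) else 0) •
            xBasis q hα t := by
        apply Subtype.ext
        rw [smul_xBasis, xTab_mul_g_of_gt t h hlt, xBasis_apply, xBasis_apply]
        rfl
      rw [h1, map_add, map_smul, embeddingLinear_xBasis, embeddingLinear_xBasis,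
        op_g_smul_vTab_of_gt hμ t h hlt]

theorem embeddingLinear_smul_xBasis_e {μ : MultiComp r n} (hμ : μ.RowsLE N)
    (hα : IsOfType μ.setPartition α) (i : Fin (n - 1)) (t : μ.RStd) :
    embeddingLinear q hμ hα (op (e q i) • xBasis q hα t) = op (e q i) • vTab R hμ t := by
  classical
  have h1 : op (e q i) • xBasis q hα t =
      if comp (t.1 (lo i)).1 = comp (t.1 (hi i)).1 then xBasis q hα t else 0 := by
    apply Subtype.ext
    rw [smul_xBasis, xTab_mul_e, apply_ite Subtype.val, xBasis_apply]
    rfl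
  rw [h1, op_e_smul_vTab, apply_ite (embeddingLinear q hμ hα), embeddingLinear_xBasis, map_zero]

/-- The formulas for generators on basis vectors extend linearly in the vector and multiplicatively
in the algebra element. -/
theorem embeddingLinear_smul {μ : MultiComp r n} (hμ : μ.RowsLE N)
    (hα : IsOfType μ.setPartition α) (a : Alg n q) (x : permModule q α μ) :
    embeddingLinear q hμ hα (op a • x) = op a • embeddingLinear q hμ hα x := by
  have gen : ∀ a : Alg n q, (∀ t, embeddingLinear q hμ hα (op a • xBasis q hα t) =
      op a • vTab R hμ t) →
      ∀ x, embeddingLinear q hμ hα (op a • x) = op a • embeddingLinear q hμ hα x := by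
    intro a ha x
    induction x using basis_induction (xBasis q hα) with
    | coe t => rw [ha, embeddingLinear_xBasis]
    | zero => simp
    | add x y hx hy => rw [smul_add, map_add, hx, hy, map_add, smul_add]
    | smul c x hx => rw [smul_comm, map_smul, hx, map_smul, smul_comm]
  induction a using Alg.induction generalizing x with
  | hR c =>
    rw [← MulOpposite.algebraMap_apply, algebraMap_smul, algebraMap_smul, map_smul]
  | hg i => exact gen _ (embeddingLinear_smul_xBasis_g hμ hα i) x
  | he i => exact gen _ (embeddingLinear_smul_xBasis_e hμ hα i) x
  | hadd a b ha hb => rw [MulOpposite.op_add, add_smul, add_smul, map_add, ha, hb]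
  | hmul a b ha hb => rw [MulOpposite.op_mul, mul_smul, mul_smul, hb, ha]

variable (q) in
/-- The embedding of a permutation module into the tensor space. -/
def embedding (μ : CompLE r N α) :
    permModule q α μ.1 →ₗ[(Alg n q)ᵐᵒᵖ] TensorSpace R n N r where
  toFun := embeddingLinear q μ.2.1 μ.2.2
  map_add' := map_add _
  map_smul' a x := embeddingLinear_smul μ.2.1 μ.2.2 (unop a) x

theorem embedding_xBasis (μ : CompLE r N α) (t : μ.1.RStd) :
    embedding q μ (xBasis q μ.2.2 t) = wordBasis R n N r (t.word μ.2.1) :=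
  (embeddingLinear_xBasis μ.2.1 μ.2.2 t).trans (vTab_eq _ _)

open Classical in
variable (q) in
/-- The `R`-linear retraction of the embedding of a permutation module that annihilates all words
of a different content. -/
def retraction (μ : CompLE r N α) : TensorSpace R n N r →ₗ[R] permModule q α μ.1 :=
  (wordBasis R n N r).constr R fun w ↦
    if h : ∃ t : μ.1.RStd, t.word μ.2.1 = w then xBasis q μ.2.2 h.choose else 0

theorem retraction_embedding_self (μ : CompLE r N α) (x : permModule q α μ.1) :
    retraction q μ (embedding q μ x) = x := by
  have : retraction q μ ∘ₗ embeddingLinear q μ.2.1 μ.2.2 = LinearMap.id := by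
    refine (xBasis q μ.2.2).ext fun t ↦ ?_
    have h : ∃ t' : μ.1.RStd, t'.word μ.2.1 = t.word μ.2.1 := ⟨t, rfl⟩
    rw [LinearMap.comp_apply, embeddingLinear_xBasis, vTab_eq, retraction,
      Module.Basis.constr_basis, dif_pos h, RStd.word_injective μ.2.1 h.choose_spec]
    rfl
  exact LinearMap.congr_fun this x

theorem retraction_embedding_of_ne {μ ν : CompLE r N α} (hne : μ ≠ ν) (x : permModule q α μ.1) :
    retraction q ν (embedding q μ x) = 0 := by
  have : retraction q ν ∘ₗ embeddingLinear q μ.2.1 μ.2.2 = 0 := by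
    refine (xBasis q μ.2.2).ext fun t ↦ ?_
    rw [LinearMap.comp_apply, embeddingLinear_xBasis, vTab_eq, retraction,
      Module.Basis.constr_basis, dif_neg]
    · rfl
    · rintro ⟨t', ht'⟩
      exact hne (Subtype.ext (eq_of_word_eq _ _ ht').symm)
  exact LinearMap.congr_fun this x

theorem embedding_injective (μ : CompLE r N α) : Function.Injective (embedding (R := R) q μ) :=
  Function.LeftInverse.injective (retraction_embedding_self μ)

/-! ### The direct sum of the permutation modules. -/

theorem idemType_smul_embedding (μ : CompLE r N α) (x : permModule q α μ.1) :
    op (idemType q α) • embedding q μ x = embedding q μ x := by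
  rw [← map_smul]
  congr 1
  induction x using basis_induction (xBasis q μ.2.2) with
  | coe t =>
    apply Subtype.ext
    rw [smul_xBasis, xTab_mul_idemType μ.2.2, xBasis_apply]
  | zero => simp
  | add x y hx hy => rw [smul_add, hx, hy]
  | smul c x hx => rw [smul_comm, hx]

open Classical in
variable (R N r q α) in
/-- The sum of all the embeddings. -/
def sumEmbedding :
    (⨁ μ : CompLE r N α, permModule q α μ.1) →ₗ[(Alg n q)ᵐᵒᵖ] TensorSpace R n N r :=
  DirectSum.toModule _ _ _ (embedding q)

open Classical in
theorem sumEmbedding_of (μ : CompLE r N α) (x : permModule q α μ.1) :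
    sumEmbedding R N r q α (DirectSum.of (fun μ : CompLE r N α ↦ permModule q α μ.1) μ x) =
      embedding q μ x :=
  DirectSum.toModule_lof (M := fun μ : CompLE r N α ↦ permModule q α μ.1) (Alg n q)ᵐᵒᵖ
    (φ := embedding q) μ x

/-- The retractions recover all components, so the sum of the embeddings is injective. -/
theorem retraction_sumEmbedding (ν : CompLE r N α)
    (x : ⨁ μ : CompLE r N α, permModule q α μ.1) :
    retraction q ν (sumEmbedding R N r q α x) = x ν := by
  classical
  induction x using DirectSum.induction_on with
  | zero => simp
  | of μ x =>
    rw [sumEmbedding_of]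
    by_cases h : μ = ν
    · subst h
      rw [retraction_embedding_self, DirectSum.of_eq_same]
    · rw [retraction_embedding_of_ne h, DirectSum.of_eq_of_ne _ _ _ (Ne.symm h)]
  | add x y hx hy => rw [map_add, map_add, hx, hy, DirectSum.add_apply]

theorem sumEmbedding_injective : Function.Injective (sumEmbedding R N r q α) := by
  intro x y h
  refine DFinsupp.ext fun ν ↦ ?_
  have h1 := congrArg (retraction q ν) h
  rwa [retraction_sumEmbedding, retraction_sumEmbedding] at h1

theorem embedding_mem_range (μ : CompLE r N α) (x : permModule q α μ.1) :
    embedding q μ x ∈ LinearMap.range (sumEmbedding R N r q α) := by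
  classical exact ⟨_, sumEmbedding_of μ x⟩

/-- On basis words 𝔼_α is the projection onto those whose partition by components has type α, and
each of them is the image of some x_t. Being the range of a module homomorphism, the image of 𝔼_α is
thereby seen to be a submodule. -/
theorem coe_range_sumEmbedding :
    (LinearMap.range (sumEmbedding R N r q α) : Set (TensorSpace R n N r)) =
      Set.range fun v : TensorSpace R n N r ↦ op (idemType q α) • v := by
  classical
  ext v
  constructor
  · rintro ⟨x, rfl⟩
    refine ⟨sumEmbedding R N r q α x, ?_⟩
    induction x using DirectSum.induction_on with
    | zero => simp
    | of μ x => simpa only [sumEmbedding_of] using idemType_smul_embedding μ x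
    | add x y hx hy =>
      simp only [map_add, smul_add] at hx hy ⊢
      rw [hx, hy]
  · rintro ⟨v, rfl⟩
    change op (idemType q α) • v ∈ LinearMap.range (sumEmbedding R N r q α)
    induction v using basis_induction (wordBasis R n N r) with
    | coe w =>
      rw [op_idemType_smul_word]
      split_ifs with h
      · have hα : IsOfType (ofWord w).setPartition α :=
          (isOfType_setPartition_iff (rstdOfWord w).1 α).1 h
        let μ : CompLE r N α := ⟨ofWord w, rowsLE_ofWord w, hα⟩
        have h1 := embedding_xBasis (q := q) μ (rstdOfWord w)
        rw [word_rstdOfWord] at h1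
        exact h1 ▸ embedding_mem_range μ _
      · exact zero_mem _
    | zero => rw [smul_zero]; exact zero_mem _
    | add x y hx hy => rw [smul_add]; exact add_mem hx hy
    | smul c x hx =>
      rw [smul_comm]
      exact Submodule.smul_of_tower_mem _ c hx

end Embedding
end BT

end

open BT Classical in
theorem theorem5p2 {R : Type*} [CommRing R] (q : Rˣ) (n r N : ℕ) (α : n.Partition) :
    ∃ ι : (μ : CompLE r N α) →
        permModule q α μ.1 →ₗ[(Alg n q)ᵐᵒᵖ] TensorSpace R n N r,
      (∀ μ : CompLE r N α,
        (∀ t : μ.1.RStd, ∃ h : xTab q t ∈ permModule q α μ.1,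
          ι μ ⟨xTab q t, h⟩ = vTab R μ.2.1 t) ∧
        (∀ f : permModule q α μ.1 →ₗ[R] TensorSpace R n N r,
          (∀ (t : μ.1.RStd) (h : xTab q t ∈ permModule q α μ.1),
            f ⟨xTab q t, h⟩ = vTab R μ.2.1 t) → ∀ x, f x = ι μ x) ∧
        Function.Injective (ι μ)) ∧
      ∃ W : Submodule (Alg n q)ᵐᵒᵖ (TensorSpace R n N r),
        (W : Set (TensorSpace R n N r)) =
          Set.range (fun v : TensorSpace R n N r ↦ MulOpposite.op (idemType q α) • v) ∧
        (∀ μ : CompLE r N α, LinearMap.range (ι μ) ≤ W) ∧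
        ∃ Φ : (⨁ μ : CompLE r N α, permModule q α μ.1) ≃ₗ[(Alg n q)ᵐᵒᵖ] W,
          ∀ (μ : CompLE r N α) (x : permModule q α μ.1),
            (Φ (DirectSum.of (fun μ : CompLE r N α ↦ permModule q α μ.1) μ x) :
              TensorSpace R n N r) = ι μ x := by
  refine ⟨embedding q, fun μ ↦ ⟨fun t ↦ ⟨xTab_mem_permModule μ.2.2 t, ?_⟩, fun f hf x ↦ ?_,
    embedding_injective μ⟩, LinearMap.range (sumEmbedding R N r q α), coe_range_sumEmbedding, ?_,
    LinearEquiv.ofInjective _ sumEmbedding_injective, fun μ x ↦ ?_⟩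
  · rw [← xBasis_apply μ.2.2, embedding_xBasis, vTab_eq]
  · have h : f = embeddingLinear q μ.2.1 μ.2.2 := by
      refine (xBasis q μ.2.2).ext fun t ↦ ?_
      rw [embeddingLinear_xBasis, xBasis_apply, hf]
    rw [h]
    rfl
  · rintro μ _ ⟨x, rfl⟩
    exact embedding_mem_range μ x
  · rw [LinearEquiv.ofInjective_apply, sumEmbedding_of]
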